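/- \textbf{Theorem} (robust frequency estimation for the Hamiltonian learning task). There are universal constants $C,c>0$ such that the following holds. Let $n\ge 1$, $M\ge 1$, $0<\eta\le 1/3$, $0<q<1$, let $P_s=\bigotimes_{i=1}^n\sigma^{\beta_i}$ be an $n$-qubit Pauli operator ($\beta_i\in\{I,x,y,z\}$), and let $j$ be a qubit with $\beta_j\neq I$. \emph{Experiments.} Write $|\pm1,\beta\rangle$ for the $\pm1$ eigenstates of $\sigma^\beta$, $\beta\in\{x,y,z\}$ ($|1,x\rangle=|+\rangle$, $|-1,x\rangle=|-\rangle$, $|\pm1,y\rangle=(|0\rangle\pm i|1\rangle)/\sqrt2$, $|1,z\rangle=|0\rangle$, $|-1,z\rangle=|1\rangle$), and $|1,I\rangle=|0\rangle$. Let $\mathcal K_{P_s}$ be the set of the $n$-qubit Pauli operators (tensor products of $I,\sigma^x,\sigma^y,\sigma^z$) that commute with $P_s$. For an $n$-qubit Hamiltonian $H$, an $(s,t,\tau)$-phase estimation experiment, where $t=r\tau$ with an integer $r\ge1$, is the following procedure. (1) Prepare the product state with qubit $j$ in the state $\frac{1}{\sqrt2}(|1,\beta_j\rangle+|-1,\beta_j\rangle)$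 and every other qubit $i$ in the state $|1,\beta_i\rangle$. (2) Draw $Q_1,\dots,Q_r$ independently and uniformly from $\mathcal K_{P_s}$ and apply the unitary $Q_re^{-iH\tau}Q_r\cdots Q_1e^{-iH\tau}Q_1$. (3) Measure on qubit $j$ one of the two single-qubit observables $Q^{+}$, $Q^-$ defined by $Q^+|\pm1,\beta_j\rangle=|\mp1,\beta_j\rangle$ and $Q^-|\pm1,\beta_j\rangle=\pm i|\mp1,\beta_j\rangle$; the outcome is $\pm1$. In a noisy experiment a quantum channel $\mathcal E_{\mathrm{prep}}$ acts after (1) and a quantum channel $\mathcal E_{\mathrm{meas}}$ acts before (3); its SPAM error is at most $\varepsilon_{\mathrm{SPAM}}$ if $\|\mathcal E_{\mathrm{prep}}-\mathcal I\|_\diamond+\|\mathcal E_{\mathrm{meas}}-\mathcal I\|_\diamond\le\varepsilon_{\mathrm{SPAM}}$. \emph{Claim.} There are a non-adaptive design, that is, a number $N_{\mathrm{exp}}$ and for each $l=1,\dots,N_{\mathrm{exp}}$ a choice of sign (of $Q^{+}$ or $Q^-$), an integer $r_l\ge1$ and a step $\tau_l>0$, with $t_l=r_l\tau_l$, and an estimator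 $\hat\theta:\{\pm1\}^{N_{\mathrm{exp}}}\to\mathbb R$, such that $$N_{\mathrm{exp}}\le C\log(1/\eta)\bigl(\log(1/q)+\log\log(1/\eta)\bigr),$$ $$T=\sum_{l=1}^{N_{\mathrm{exp}}}t_l\le \frac{C}{\eta}\bigl(\log(1/q)+\log\log(1/\eta)\bigr),\qquad \max_l t_l\le \frac{C}{\eta},\qquad \tau_l\ge\frac{c}{M^2t_l}\ \text{ for all } l,$$ and such that for every traceless Hamiltonian $H=\sum_{s'}\mu_{s'}P_{s'}$ (the sum runs over the non-identity $n$-qubit Pauli operators, the coefficients are real) with at most $M$ nonzero coefficients and $|\mu_{s'}|\le 1$ for all $s'$, if the $N_{\mathrm{exp}}$ experiments of the design are performed independently, each with SPAM error at most $\varepsilon_{\mathrm{SPAM}}\le 1/(3\sqrt2)$ (the noise channels may differ from experiment to experiment), then the value $\hat\theta$ of the estimator on the outcomes satisfies $$\Pr\bigl[\,|\hat\theta-2\mu_s|\ge\eta\,\bigr]\le q .$$ -/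

import Mathlib

open Matrix
open scoped ENNReal ComplexOrder

noncomputable section

namespace HamLearn

/-! ### Density matrices, quantum channels, trace norm and diamond norm -/

section Channels

variable {ι κ : Type} [Fintype ι] [DecidableEq ι] [Fintype κ] [DecidableEq κ]

/-- A density matrix: a positive semidefinite matrix of trace one. -/
structure DensityMatrix (ι : Type) [Fintype ι] [DecidableEq ι] where
  mat : Matrix ι ι ℂ
  posSemidef : mat.PosSemidef
  trace_eq : mat.trace = 1

/-- A quantum channel in Kraus form: `Λ ρ = ∑ K_k ρ K_kᴴ` with `∑ K_kᴴ K_k = 1`. -/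
structure QuantumChannel (ι : Type) [Fintype ι] [DecidableEq ι] where
  map : Matrix ι ι ℂ →ₗ[ℂ] Matrix ι ι ℂ
  kraus : ∃ (m : ℕ) (K : Fin m → Matrix ι ι ℂ),
    (∀ X, map X = ∑ k, K k * X * (K k)ᴴ) ∧ ∑ k, (K k)ᴴ * K k = 1

/-- The action of a channel on a state. -/
def QuantumChannel.apply (Λ : QuantumChannel ι) (ρ : DensityMatrix ι) : DensityMatrix ι where
  mat := Λ.map ρ.mat
  posSemidef := by
    obtain ⟨m, K, hK, -⟩ := Λ.kraus
    rw [hK]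
    exact posSemidef_sum _ fun k _ => ρ.posSemidef.mul_mul_conjTranspose_same (K k)
  trace_eq := by
    obtain ⟨m, K, hK, h1⟩ := Λ.kraus
    rw [hK, trace_sum]
    have : ∀ k, (K k * ρ.mat * (K k)ᴴ).trace = ((K k)ᴴ * K k * ρ.mat).trace := fun k => by
      rw [trace_mul_comm, ← Matrix.mul_assoc]
    simp only [this]
    rw [← trace_sum, ← Finset.sum_mul, h1, one_mul, ρ.trace_eq]

/-- Unitary evolution `ρ ↦ U ρ Uᴴ`. -/
def DensityMatrix.evolve (U : unitaryGroup ι ℂ) (ρ : DensityMatrix ι) : DensityMatrix ι where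
  mat := (U : Matrix ι ι ℂ) * ρ.mat * (U : Matrix ι ι ℂ)ᴴ
  posSemidef := ρ.posSemidef.mul_mul_conjTranspose_same _
  trace_eq := by
    have h : (U : Matrix ι ι ℂ)ᴴ * (U : Matrix ι ι ℂ) = 1 := Unitary.coe_star_mul_self U
    rw [trace_mul_comm, ← Matrix.mul_assoc, h, one_mul, ρ.trace_eq]

/-- The state `|v⟩⟨v|` of a unit vector. -/
def pureState (v : ι → ℂ) (hv : star v ⬝ᵥ v = 1) : DensityMatrix ι where
  mat := vecMulVec v (star v)
  posSemidef := posSemidef_vecMulVec_self_star v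
  trace_eq := by rw [trace_vecMulVec, dotProduct_comm, hv]

/-- The probability of the outcome `+1` (`b = true`) or `-1` (`b = false`) when the `±1`-valued
observable `O` is measured in the state `ρ`: the Born rule `tr(Π_± ρ)`, `Π_± = (1 ± O) / 2`. -/
def bornProb (O : Matrix ι ι ℂ) (ρ : DensityMatrix ι) (b : Bool) : ℝ :=
  (((1 / 2 : ℂ) • (1 + (if b then (1 : ℂ) else -1) • O)) * ρ.mat).trace.re

theorem bornProb_nonneg {O : Matrix ι ι ℂ} (hO : O.IsHermitian) (hO2 : O * O = 1)
    (ρ : DensityMatrix ι) (b : Bool) : 0 ≤ bornProb O ρ b := by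
  unfold bornProb
  set P : Matrix ι ι ℂ := (1 / 2 : ℂ) • (1 + (if b then (1 : ℂ) else -1) • O) with hP
  have hH : Pᴴ = P := by
    rw [hP]
    cases b <;> simp [hO.eq]
  have hPP : P * P = P := by
    rw [hP]
    cases b <;>
      simp only [smul_mul_assoc, mul_smul_comm, mul_add, add_mul, hO2, mul_one, one_mul, if_true,
        Bool.false_eq_true, if_false, one_smul, neg_smul, neg_mul, mul_neg] <;> module
  have h : (P * ρ.mat).trace = (P * ρ.mat * Pᴴ).trace := by
    rw [hH, trace_mul_comm (P * ρ.mat), ← Matrix.mul_assoc, hPP]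
  rw [h]
  have := (ρ.posSemidef.mul_mul_conjTranspose_same P).trace_nonneg
  exact (Complex.le_def.1 this).1

theorem bornProb_add (O : Matrix ι ι ℂ) (ρ : DensityMatrix ι) :
    bornProb O ρ true + bornProb O ρ false = 1 := by
  unfold bornProb
  rw [← Complex.add_re, ← trace_add, ← add_mul]
  have : ((1 / 2 : ℂ) • (1 + (if true then (1 : ℂ) else -1) • O) +
      (1 / 2 : ℂ) • (1 + (if false then (1 : ℂ) else -1) • O)) = 1 := by
    simp only [if_true, Bool.false_eq_true, if_false]
    module
  rw [this, one_mul, ρ.trace_eq, Complex.one_re]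

/-- The law of the `±1` outcome (`true` stands for `+1`, `false` for `-1`) of a measurement of the
observable `O` (Hermitian with `O² = 1`) in the state `ρ`. -/
def measure (O : Matrix ι ι ℂ) (hO : O.IsHermitian) (hO2 : O * O = 1) (ρ : DensityMatrix ι) :
    PMF Bool :=
  PMF.ofFintype (fun b => ENNReal.ofReal (bornProb O ρ b)) (by
    rw [Fintype.sum_bool, ← ENNReal.ofReal_add (bornProb_nonneg hO hO2 ρ true)
      (bornProb_nonneg hO hO2 ρ false), bornProb_add, ENNReal.ofReal_one])

/-- The Schatten 1-norm `‖X‖₁ = tr √(Xᴴ X)`, as the sum of the singular values of `X`. -/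
def traceNorm (X : Matrix ι ι ℂ) : ℝ :=
  ∑ i, √((isHermitian_conjTranspose_mul_self X).eigenvalues i)

/-- `Φ ⊗ id` on matrices over the product system `ι × κ`. -/
def ampliation (Φ : Matrix ι ι ℂ →ₗ[ℂ] Matrix ι ι ℂ) (X : Matrix (ι × κ) (ι × κ) ℂ) :
    Matrix (ι × κ) (ι × κ) ℂ :=
  Matrix.of fun p q => Φ (Matrix.of fun a b => X (a, p.2) (b, q.2)) p.1 q.1

/-- The diamond norm `‖Φ‖_⋄ = sup {‖(Φ ⊗ id)(X)‖₁ : ‖X‖₁ ≤ 1}`, the ancilla being a copy of the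
system; it is a supremum in `[0, ∞]`. -/
def diamondNorm (Φ : Matrix ι ι ℂ →ₗ[ℂ] Matrix ι ι ℂ) : ℝ≥0∞ :=
  ⨆ (X : Matrix (ι × ι) (ι × ι) ℂ) (_ : traceNorm X ≤ 1),
    ENNReal.ofReal (traceNorm (ampliation Φ X))

/-- SPAM noise of strength at most `ε`: a channel `prep` acting after the ideal preparation and a
channel `meas` acting before the ideal measurement, with
`‖prep - id‖_⋄ + ‖meas - id‖_⋄ ≤ ε`. -/
structure SPAMNoise (ι : Type) [Fintype ι] [DecidableEq ι] (ε : ℝ) where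
  prep : QuantumChannel ι
  meas : QuantumChannel ι
  bound : diamondNorm (prep.map - LinearMap.id) + diamondNorm (meas.map - LinearMap.id)
    ≤ ENNReal.ofReal ε

end Channels

/-! ### Pauli operators and Hamiltonians on `n` qubits -/

/-- The labels `I, x, y, z` of the single-qubit Pauli matrices. -/
inductive Pauli
  | I | x | y | z
  deriving DecidableEq

instance : Fintype Pauli := ⟨{.I, .x, .y, .z}, fun p => by cases p <;> simp⟩

/-- The Pauli matrices. -/
def Pauli.mat : Pauli → Matrix (Fin 2) (Fin 2) ℂ
  | .I => 1
  | .x => !![0, 1; 1, 0]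
  | .y => !![0, -Complex.I; Complex.I, 0]
  | .z => !![1, 0; 0, -1]

/-- The computational basis labels of `n` qubits. -/
abbrev Qubits (n : ℕ) : Type := Fin n → Fin 2

/-- The tensor product `⨂ j, A j` of single-qubit operators. -/
def tensorOp {n : ℕ} (A : Fin n → Matrix (Fin 2) (Fin 2) ℂ) : Matrix (Qubits n) (Qubits n) ℂ :=
  Matrix.of fun a b => ∏ j, A j (a j) (b j)

/-- The tensor product `⨂ j, v j` of single-qubit vectors. -/
def tensorVec {n : ℕ} (v : Fin n → Fin 2 → ℂ) : Qubits n → ℂ := fun a => ∏ j, v j (a j)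

/-- Labels `s` of the `n`-qubit Pauli operators; the constant string `I` labels the identity. -/
abbrev PauliString (n : ℕ) : Type := Fin n → Pauli

/-- The `n`-qubit Pauli operator `P_s`. -/
def PauliString.op {n : ℕ} (s : PauliString n) : Matrix (Qubits n) (Qubits n) ℂ :=
  tensorOp fun j => (s j).mat

/-- The Hamiltonian `H = ∑ s, μ_s P_s`. -/
def hamiltonian {n : ℕ} (μ : PauliString n → ℝ) : Matrix (Qubits n) (Qubits n) ℂ :=
  ∑ s, (μ s : ℂ) • s.op

/-- `μ` is the coefficient vector of a traceless Hamiltonian with at most `M` terms, all of whose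
coefficients are at most `1` in absolute value. -/
structure IsAdmissible {n : ℕ} (M : ℕ) (μ : PauliString n → ℝ) : Prop where
  traceless : μ (fun _ => Pauli.I) = 0
  terms : {s | μ s ≠ 0}.ncard ≤ M
  bounded : ∀ s, |μ s| ≤ 1

theorem tensorOp_mul {n : ℕ} (A B : Fin n → Matrix (Fin 2) (Fin 2) ℂ) :
    tensorOp A * tensorOp B = tensorOp fun j => A j * B j := by
  ext a b
  simp only [tensorOp, Matrix.mul_apply, Matrix.of_apply, ← Finset.prod_mul_distrib]
  rw [Finset.prod_univ_sum, Fintype.piFinset_univ]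

theorem tensorOp_one {n : ℕ} : tensorOp (fun _ : Fin n => 1) = 1 := by
  ext a b
  simp only [tensorOp, Matrix.of_apply, Matrix.one_apply, Finset.prod_ite_zero, funext_iff]
  simp

theorem tensorOp_conjTranspose {n : ℕ} (A : Fin n → Matrix (Fin 2) (Fin 2) ℂ) :
    (tensorOp A)ᴴ = tensorOp fun j => (A j)ᴴ := by
  ext a b
  simp [tensorOp, Matrix.conjTranspose_apply]

theorem Pauli.mat_conjTranspose (p : Pauli) : p.matᴴ = p.mat := by
  cases p <;> ext i j <;> fin_cases i <;> fin_cases j <;> simp [Pauli.mat, conjTranspose_apply]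

theorem Pauli.mat_mul_self (p : Pauli) : p.mat * p.mat = 1 := by
  cases p <;> ext i j <;> fin_cases i <;> fin_cases j <;> simp [Pauli.mat]

theorem PauliString.op_conjTranspose {n : ℕ} (s : PauliString n) : s.opᴴ = s.op := by
  simp only [op, tensorOp_conjTranspose, Pauli.mat_conjTranspose]

theorem PauliString.op_mul_self {n : ℕ} (s : PauliString n) : s.op * s.op = 1 := by
  simp only [op, tensorOp_mul, Pauli.mat_mul_self, tensorOp_one]

/-- A Pauli operator as a unitary. -/
def PauliString.unitary {n : ℕ} (s : PauliString n) : unitaryGroup (Qubits n) ℂ :=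
  ⟨s.op, mem_unitaryGroup_iff.2 (by
    rw [star_eq_conjTranspose, s.op_conjTranspose, s.op_mul_self])⟩

theorem hamiltonian_conjTranspose {n : ℕ} (μ : PauliString n → ℝ) :
    (hamiltonian μ)ᴴ = hamiltonian μ := by
  simp [hamiltonian, conjTranspose_sum, conjTranspose_smul, PauliString.op_conjTranspose]

/-- The time evolution `exp(-i H τ)`. -/
def timeEvolution {n : ℕ} (μ : PauliString n → ℝ) (τ : ℝ) : unitaryGroup (Qubits n) ℂ :=
  ⟨NormedSpace.exp ((-Complex.I * (τ : ℂ)) • hamiltonian μ), mem_unitaryGroup_iff'.2 (by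
    rw [star_eq_conjTranspose, ← Matrix.exp_conjTranspose, conjTranspose_smul,
      hamiltonian_conjTranspose]
    have h : star (-Complex.I * (τ : ℂ)) = -(-Complex.I * (τ : ℂ)) := by simp
    rw [h, neg_smul, Matrix.exp_neg]
    exact Matrix.nonsing_inv_mul _ ((Matrix.isUnit_iff_isUnit_det _).1 (Matrix.isUnit_exp _)))⟩

/-! ### Hamiltonian reshaping -/

open Classical in
/-- The set `𝒦_{P_s}` of the `n`-qubit Pauli operators that commute with `P_s`. -/
def reshapingSet {n : ℕ} (s : PauliString n) : Finset (PauliString n) :=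
  Finset.univ.filter fun Q => Q.op * s.op = s.op * Q.op

theorem reshapingSet_nonempty {n : ℕ} (s : PauliString n) : (reshapingSet s).Nonempty :=
  ⟨s, by simp [reshapingSet]⟩

/-- The unitary `(Q_r e^{-iHτ} Q_r) ⋯ (Q_2 e^{-iHτ} Q_2) (Q_1 e^{-iHτ} Q_1)`. -/
def reshapedEvolution {n r : ℕ} (μ : PauliString n → ℝ) (τ : ℝ) (Q : Fin r → PauliString n) :
    unitaryGroup (Qubits n) ℂ :=
  (List.ofFn fun k => (Q k).unitary * timeEvolution μ τ * (Q k).unitary).reverse.prod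

/-! ### The phase estimation experiment -/

/-- The single-qubit states `|1, β⟩` (`b = true`) and `|-1, β⟩` (`b = false`). -/
def ket (b : Bool) : Pauli → Fin 2 → ℂ
  | .I => ![1, 0]
  | .x => ![1 / (√2 : ℝ), (if b then 1 else -1) * (1 / (√2 : ℝ))]
  | .y => ![1 / (√2 : ℝ), (if b then 1 else -1) * (Complex.I / (√2 : ℝ))]
  | .z => if b then ![1, 0] else ![0, 1]

/-- The state `(|1, β⟩ + |-1, β⟩) / √2` of the probe qubit. -/
def superposition (β : Pauli) : Fin 2 → ℂ :=
  fun i => (1 / (√2 : ℝ) : ℂ) * (ket true β i + ket false β i)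

/-- The product input state: `(|1, s_j⟩ + |-1, s_j⟩) / √2` on the probe qubit `j` and
`|1, s_i⟩` on every other qubit `i`. -/
def probeVec {n : ℕ} (s : PauliString n) (j : Fin n) : Qubits n → ℂ :=
  tensorVec fun i => if i = j then superposition (s i) else ket true (s i)

/-- The single-qubit observables `Q⁺` (`b = true`) and `Q⁻` (`b = false`) attached to
`β ∈ {x, y, z}`; they are Pauli matrices up to sign, and are characterized by
`probeObs_mulVec_ket` below. (The value at `I` is irrelevant.) -/
def probeObs (b : Bool) : Pauli → Matrix (Fin 2) (Fin 2) ℂ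
  | .I => 1
  | .x => if b then Pauli.z.mat else -Pauli.y.mat
  | .y => if b then Pauli.z.mat else Pauli.x.mat
  | .z => if b then Pauli.x.mat else Pauli.y.mat

/-- `Q⁺|±1, β⟩ = |∓1, β⟩`, `Q⁻|1, β⟩ = i|-1, β⟩` and `Q⁻|-1, β⟩ = -i|1, β⟩`. -/
theorem probeObs_mulVec_ket (β : Pauli) (hβ : β ≠ .I) :
    probeObs true β *ᵥ ket true β = ket false β ∧
    probeObs true β *ᵥ ket false β = ket true β ∧
    probeObs false β *ᵥ ket true β = Complex.I • ket false β ∧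
    probeObs false β *ᵥ ket false β = -Complex.I • ket true β := by
  cases β
  · exact absurd rfl hβ
  all_goals
    refine ⟨?_, ?_, ?_, ?_⟩ <;> ext i <;> fin_cases i <;>
      simp [probeObs, ket, Pauli.mat, Matrix.mulVec, dotProduct, Fin.sum_univ_two] <;>
      ring_nf <;> simp

/-- The `n`-qubit observable `O_s^±`: `Q^±` on the probe qubit `j`, identity elsewhere. -/
def observable {n : ℕ} (b : Bool) (s : PauliString n) (j : Fin n) :
    Matrix (Qubits n) (Qubits n) ℂ :=
  tensorOp fun i => if i = j then probeObs b (s i) else 1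

theorem probeObs_conjTranspose (b : Bool) (β : Pauli) : (probeObs b β)ᴴ = probeObs b β := by
  cases β <;> cases b <;> simp [probeObs, Pauli.mat_conjTranspose]

theorem probeObs_mul_self (b : Bool) (β : Pauli) : probeObs b β * probeObs b β = 1 := by
  cases β <;> cases b <;> simp [probeObs, Pauli.mat_mul_self]

theorem observable_isHermitian {n : ℕ} (b : Bool) (s : PauliString n) (j : Fin n) :
    (observable b s j).IsHermitian := by
  unfold observable Matrix.IsHermitian
  rw [tensorOp_conjTranspose]
  congr 1
  funext i
  split_ifs <;> simp [probeObs_conjTranspose]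

theorem observable_mul_self {n : ℕ} (b : Bool) (s : PauliString n) (j : Fin n) :
    observable b s j * observable b s j = 1 := by
  unfold observable
  rw [tensorOp_mul, ← tensorOp_one]
  congr 1
  funext i
  split_ifs <;> simp [probeObs_mul_self]

theorem tensorVec_norm {n : ℕ} (v : Fin n → Fin 2 → ℂ) (hv : ∀ j, star (v j) ⬝ᵥ v j = 1) :
    star (tensorVec v) ⬝ᵥ tensorVec v = 1 := by
  have h : star (tensorVec v) ⬝ᵥ tensorVec v = ∏ j, (star (v j) ⬝ᵥ v j) := by
    simp only [dotProduct, tensorVec, Pi.star_apply, star_prod, ← Finset.prod_mul_distrib]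
    rw [Finset.prod_univ_sum, Fintype.piFinset_univ]
  rw [h]
  exact Finset.prod_eq_one fun j _ => hv j

theorem sqrt_two_mul_self : ((√2 : ℝ) : ℂ) * ((√2 : ℝ) : ℂ) = 2 := by
  rw [← Complex.ofReal_mul, Real.mul_self_sqrt (by norm_num)]
  norm_num

theorem ket_norm (b : Bool) (β : Pauli) : star (ket b β) ⬝ᵥ ket b β = 1 := by
  have h2 := sqrt_two_mul_self
  have h0 : ((√2 : ℝ) : ℂ) ≠ 0 := by
    intro h
    rw [h] at h2
    norm_num at h2
  cases β <;> cases b <;>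
    simp only [ket, dotProduct, Fin.sum_univ_two, Pi.star_apply] <;> simp <;> field_simp <;>
    first | linear_combination -h2 | linear_combination -h2 - Complex.I_sq

theorem superposition_norm (β : Pauli) (hβ : β ≠ .I) :
    star (superposition β) ⬝ᵥ superposition β = 1 := by
  have h2 := sqrt_two_mul_self
  have h0 : ((√2 : ℝ) : ℂ) ≠ 0 := by
    intro h
    rw [h] at h2
    norm_num at h2
  have h4 : ((√2 : ℝ) : ℂ) ^ 4 = 4 := by linear_combination (((√2 : ℝ) : ℂ) ^ 2 + 2) * h2
  cases β
  · exact absurd rfl hβ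
  all_goals
    simp only [superposition, ket, dotProduct, Fin.sum_univ_two, Pi.star_apply]
    simp
    field_simp
    first | linear_combination -h2 | linear_combination -h4

theorem probeVec_norm {n : ℕ} (s : PauliString n) (j : Fin n) (hj : s j ≠ .I) :
    star (probeVec s j) ⬝ᵥ probeVec s j = 1 := by
  refine tensorVec_norm _ fun i => ?_
  split_ifs with h
  · subst h
    exact superposition_norm _ hj
  · exact ket_norm _ _

/-- The law of the outcome of one `(s, t, τ)`-phase estimation experiment with `t = r τ` under SPAM
noise: prepare the product input state, let `prep` act, draw `Q_1, …, Q_r` independently and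
uniformly from `𝒦_{P_s}`, evolve under `H` with the reshaping pulses `Q_k`, let `meas` act, and
measure `O_s⁺` (`b = true`) or `O_s⁻` (`b = false`). The qubit `j` is one on which `P_s` acts
nontrivially. -/
def phaseExperiment {n : ℕ} {ε : ℝ} (μ : PauliString n → ℝ) (s : PauliString n) (j : Fin n)
    (hj : s j ≠ .I) (noise : SPAMNoise (Qubits n) ε) (b : Bool) (r : ℕ) (τ : ℝ) : PMF Bool :=
  (PMF.uniformOfFinset (Fintype.piFinset fun _ : Fin r => reshapingSet s)
      (Fintype.piFinset_nonempty.2 fun _ => reshapingSet_nonempty s)).bind fun Q =>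
    measure (observable b s j) (observable_isHermitian b s j) (observable_mul_self b s j)
      (noise.meas.apply
        ((noise.prep.apply (pureState (probeVec s j) (probeVec_norm s j hj))).evolve
          (reshapedEvolution μ τ Q)))

end HamLearn

end

open HamLearn

/-! Conjugating `H` by a uniformly random Pauli operator commuting with `P_s` averages it to `μ_s
P_s`, by orthogonality of commutation signs (`sum_reshapingSet_conj_hamiltonian`). In the Heisenberg
picture, one averaged pulsed step is therefore conjugation by `exp(-i μ_s τ P_s)` up to `O((Mτ)²)`.
Independent steps compose and averaged steps are contractions, so `r` of them cost `O(r (Mτ)²)`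
(`norm_iterate_averagedStep_sub_le`), a small constant once `τ` is a small multiple of `1/(M² t)`.
As `P_s` anticommutes with the measured observable, the ideal mean outcome is `cos` or `sin` of `2
μ_s t` (`expectation_rotation`); by trace norm duality SPAM noise shifts it by at most `ε`
(`SPAMNoise.norm_trace_sub_le`).

It remains to recover `θ = 2 μ_s` from values of `cos (2^k θ)` and `sin (2^k θ)` known within `1/3`.
Two phases in `[-2, 2]` that both fit such data up to scale `2^K` differ by less than `(π/3)/2^K`
(`PhaseConsistent.abs_sub_lt`), because each scale rules out wrap-around at the next; so any
consistent phase is a good estimate. Constant accuracy per scale is enough: Hoeffding and a union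
bound over `O(log (1/η))` block averages require `O(log (1/q) + log log (1/η))` shots each, and the
times `2^k` sum geometrically to `O(1/η)`. The error budget is `0.2358` (SPAM) plus `0.026`
(reshaping) plus `0.07` (sampling), below `1/3`. -/

section

open scoped Kronecker

/-! ### Trace norm duality and the effect of SPAM noise -/

theorem Matrix.row_sum_norm_sq_of_mem_unitaryGroup {ι : Type} [Fintype ι] [DecidableEq ι]
    {U : Matrix ι ι ℂ} (hU : U ∈ unitaryGroup ι ℂ) (i : ι) : ∑ k, ‖U i k‖ ^ 2 = 1 := by
  have h := congrFun (congrFun (mem_unitaryGroup_iff.1 hU) i) i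
  rw [Matrix.mul_apply, one_apply_eq] at h
  have h2 : ((∑ k, ‖U i k‖ ^ 2 : ℝ) : ℂ) = 1 := by
    rw [← h]
    push_cast
    refine Finset.sum_congr rfl fun k _ => ?_
    rw [star_apply]
    exact (Complex.mul_conj' _).symm
  exact_mod_cast h2

/-- In an eigenbasis `V` of `Xᴴ X`, the columns of `X V` have the singular values as lengths;
Cauchy-Schwarz pairs each with a unit row of the unitary `Vᴴ U`. -/
theorem Matrix.norm_trace_unitary_mul_le_traceNorm {ι : Type} [Fintype ι] [DecidableEq ι]
    {U : Matrix ι ι ℂ} (hU : U ∈ unitaryGroup ι ℂ) (X : Matrix ι ι ℂ) :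
    ‖(U * X).trace‖ ≤ traceNorm X := by
  set h := isHermitian_conjTranspose_mul_self X
  set V : Matrix ι ι ℂ := (h.eigenvectorUnitary : Matrix ι ι ℂ)
  have hV : V ∈ unitaryGroup ι ℂ := h.eigenvectorUnitary.2
  have hdiag : Vᴴ * (Xᴴ * X) * V = diagonal (fun i => (h.eigenvalues i : ℂ)) := by
    have := h.conjStarAlgAut_star_eigenvectorUnitary
    rw [Unitary.conjStarAlgAut_star_apply] at this
    exact this
  set W := X * V with hW
  have hWW : ∀ i, ∑ k, ‖W k i‖ ^ 2 = h.eigenvalues i := fun i => by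
    have h1 : Wᴴ * W = diagonal (fun i => (h.eigenvalues i : ℂ)) := by
      rw [← hdiag, hW, conjTranspose_mul]
      simp only [Matrix.mul_assoc]
    have h2 := congrFun (congrFun h1 i) i
    rw [Matrix.mul_apply, diagonal_apply_eq] at h2
    have h3 : ((∑ k, ‖W k i‖ ^ 2 : ℝ) : ℂ) = h.eigenvalues i := by
      rw [← h2]
      push_cast
      refine Finset.sum_congr rfl fun k _ => ?_
      rw [conjTranspose_apply]
      exact (Complex.conj_mul' _).symm
    exact_mod_cast h3
  have hG : Vᴴ * U ∈ unitaryGroup ι ℂ := mul_mem (Unitary.star_mem hV) hU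
  have htr : (U * X).trace = ((Vᴴ * U) * W).trace := by
    have hVV : V * Vᴴ = 1 := mem_unitaryGroup_iff.1 hV
    rw [hW, trace_mul_comm (Vᴴ * U), ← Matrix.mul_assoc (X * V), Matrix.mul_assoc X, hVV, mul_one,
      trace_mul_comm]
  rw [htr, Matrix.trace, traceNorm]
  refine (norm_sum_le _ _).trans (Finset.sum_le_sum fun i _ => ?_)
  rw [diag_apply, Matrix.mul_apply]
  refine (norm_sum_le _ _).trans ?_
  simp only [norm_mul]
  refine (Real.sum_mul_le_sqrt_mul_sqrt _ _ _).trans ?_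
  rw [row_sum_norm_sq_of_mem_unitaryGroup hG, hWW, Real.sqrt_one, one_mul]

open scoped MatrixOrder Matrix.Norms.L2Operator in
-- Uniqueness of positive square roots: in an eigenbasis of `Yᴴ Y = Y²`, both `Y` and the diagonal
-- of singular values are positive roots of the same matrix.
theorem Matrix.PosSemidef.traceNorm_eq {ι : Type} [Fintype ι] [DecidableEq ι]
    {Y : Matrix ι ι ℂ} (hY : Y.PosSemidef) : traceNorm Y = Y.trace.re := by
  set h := isHermitian_conjTranspose_mul_self Y
  set V : Matrix ι ι ℂ := (h.eigenvectorUnitary : Matrix ι ι ℂ)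
  have hVV : V * Vᴴ = 1 := mem_unitaryGroup_iff.1 h.eigenvectorUnitary.2
  have hdiag : Vᴴ * (Yᴴ * Y) * V = diagonal (fun i => (h.eigenvalues i : ℂ)) := by
    have := h.conjStarAlgAut_star_eigenvectorUnitary
    rw [Unitary.conjStarAlgAut_star_apply] at this
    exact this
  have hnn : ∀ i, 0 ≤ h.eigenvalues i :=
    (posSemidef_conjTranspose_mul_self Y).eigenvalues_nonneg
  have hZ : (Vᴴ * Y * V).PosSemidef := hY.conjTranspose_mul_mul_same V
  have hD : (diagonal (fun i => ((√(h.eigenvalues i) : ℝ) : ℂ))).PosSemidef :=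
    PosSemidef.diagonal fun i => Complex.zero_le_real.2 (Real.sqrt_nonneg _)
  have hZD : Vᴴ * Y * V = diagonal (fun i => ((√(h.eigenvalues i) : ℝ) : ℂ)) := by
    rw [← CFC.mul_self_eq_mul_self_iff _ _ (nonneg_iff_posSemidef.2 hZ)
      (nonneg_iff_posSemidef.2 hD)]
    have h1 : Vᴴ * Y * V * (Vᴴ * Y * V) = Vᴴ * (Yᴴ * Y) * V := by
      rw [hY.isHermitian.eq, ← Matrix.mul_assoc, ← Matrix.mul_assoc, Matrix.mul_assoc (Vᴴ * Y), hVV,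
        mul_one, Matrix.mul_assoc Vᴴ Y Y]
    rw [h1, hdiag, diagonal_mul_diagonal]
    congr 1
    funext i
    rw [← Complex.ofReal_mul, Real.mul_self_sqrt (hnn i)]
  have htr : Y.trace = (Vᴴ * Y * V).trace := by
    rw [trace_mul_comm, ← Matrix.mul_assoc, hVV, one_mul]
  rw [htr, hZD, trace_diagonal, ← Complex.ofReal_sum, Complex.ofReal_re]
  rfl

theorem HamLearn.ampliation_kronecker {ι κ : Type} [Fintype ι] [DecidableEq ι]
    (Φ : Matrix ι ι ℂ →ₗ[ℂ] Matrix ι ι ℂ) (X : Matrix ι ι ℂ) (E : Matrix κ κ ℂ) :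
    ampliation Φ (X ⊗ₖ E) = Φ X ⊗ₖ E := by
  ext p q
  have : (Matrix.of fun a b => (X ⊗ₖ E) (a, p.2) (b, q.2)) = E p.2 q.2 • X := by
    ext a b
    simp [kroneckerMap_apply, mul_comm]
  rw [ampliation, Matrix.of_apply, this, map_smul, Matrix.smul_apply, kroneckerMap_apply,
    smul_eq_mul, mul_comm]

theorem HamLearn.norm_trace_unitary_mul_le_diamondNorm {ι : Type} [Fintype ι] [DecidableEq ι]
    (Φ : Matrix ι ι ℂ →ₗ[ℂ] Matrix ι ι ℂ) {A : Matrix ι ι ℂ} (hA : A ∈ unitaryGroup ι ℂ)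
    (ρ : DensityMatrix ι) :
    ENNReal.ofReal ‖(A * Φ ρ.mat).trace‖ ≤ diamondNorm Φ := by
  rcases isEmpty_or_nonempty ι with h | ⟨⟨i⟩⟩
  · simp [Matrix.trace]
  -- The test input is `ρ ⊗ E` with an uncorrelated pure ancilla state; entanglement with the
  -- ancilla is not needed here.
  set E : Matrix ι ι ℂ := single i i 1 with hE
  have hEp : E.PosSemidef := by
    rw [hE, ← diagonal_single]
    refine PosSemidef.diagonal fun k => ?_
    by_cases hk : k = i
    · subst hk; simp
    · simp [hk]
  have hEt : E.trace = 1 := by simp [hE]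
  have hX : traceNorm (ρ.mat ⊗ₖ E) ≤ 1 := by
    rw [(ρ.posSemidef.kronecker hEp).traceNorm_eq, trace_kronecker, ρ.trace_eq, hEt]
    simp
  refine le_trans (ENNReal.ofReal_le_ofReal ?_)
    (le_iSup₂ (f := fun X (_ : traceNorm X ≤ 1) => ENNReal.ofReal (traceNorm (ampliation Φ X)))
      (ρ.mat ⊗ₖ E) hX)
  have hU : A ⊗ₖ (1 : Matrix ι ι ℂ) ∈ unitaryGroup (ι × ι) ℂ :=
    kronecker_mem_unitary hA (one_mem _)
  have h := norm_trace_unitary_mul_le_traceNorm hU (ampliation Φ (ρ.mat ⊗ₖ E))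
  rwa [ampliation_kronecker, ← mul_kronecker_mul, trace_kronecker, one_mul, hEt, mul_one,
    ← ampliation_kronecker] at h

/-- SPAM noise of strength `ε` changes the expectation of a `±1`-valued observable after a unitary
evolution by at most `ε`. -/
theorem HamLearn.SPAMNoise.norm_trace_sub_le {ι : Type} [Fintype ι] [DecidableEq ι] {ε : ℝ}
    (hε : 0 ≤ ε)
    (noise : SPAMNoise ι ε) {O : Matrix ι ι ℂ} (hO : O ∈ unitaryGroup ι ℂ)
    (U : unitaryGroup ι ℂ) (ρ : DensityMatrix ι) :
    ‖(O * (noise.meas.apply ((noise.prep.apply ρ).evolve U)).mat).trace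
      - (O * (ρ.evolve U).mat).trace‖ ≤ ε := by
  set σ := (noise.prep.apply ρ).evolve U with hσ
  set A : Matrix ι ι ℂ := (U : Matrix ι ι ℂ)ᴴ * O * (U : Matrix ι ι ℂ) with hAdef
  have hA : A ∈ unitaryGroup ι ℂ := mul_mem (mul_mem (Unitary.star_mem U.2) hO) U.2
  have h1 := norm_trace_unitary_mul_le_diamondNorm (noise.meas.map - LinearMap.id) hO σ
  have h2 := norm_trace_unitary_mul_le_diamondNorm (noise.prep.map - LinearMap.id) hA ρ
  have h3 := (add_le_add h2 h1).trans noise.bound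
  rw [← ENNReal.ofReal_add (norm_nonneg _) (norm_nonneg _), ENNReal.ofReal_le_ofReal_iff hε] at h3
  have hev : ∀ τ : DensityMatrix ι, (O * (τ.evolve U).mat).trace = (A * τ.mat).trace := fun τ => by
    rw [DensityMatrix.evolve, hAdef, ← Matrix.mul_assoc, trace_mul_comm]
    simp only [Matrix.mul_assoc]
  -- Telescoping: the measurement error is tested by `O` on the noisy evolved state, the preparation
  -- error by the Heisenberg-evolved observable `Uᴴ O U`, which is again unitary.
  have hsplit : (O * (noise.meas.apply σ).mat).trace - (O * (ρ.evolve U).mat).trace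
      = (A * (noise.prep.map - LinearMap.id : _ →ₗ[ℂ] _) ρ.mat).trace
        + (O * (noise.meas.map - LinearMap.id : _ →ₗ[ℂ] _) σ.mat).trace := by
    simp only [LinearMap.sub_apply, LinearMap.id_apply, mul_sub, trace_sub]
    rw [hev ρ, hσ, hev]
    simp only [QuantumChannel.apply]
    ring
  rw [hsplit]
  exact (norm_add_le _ _).trans h3

/-! ### Second-order expansion of conjugations -/

theorem NormedSpace.norm_exp_sub_one_sub_id_le {𝔸 : Type*} [NormedRing 𝔸] [NormedAlgebra ℂ 𝔸]
    [CompleteSpace 𝔸] {X : 𝔸} (hX : ‖X‖ ≤ 1) :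
    ‖NormedSpace.exp X - 1 - X‖ ≤ ‖X‖ ^ 2 := by
  have h1 := NormedSpace.exp_series_hasSum_exp' (𝕂 := ℂ) X
  have h2 := NormedSpace.exp_series_hasSum_exp' (𝕂 := ℝ) (‖X‖)
  -- With the first two terms removed, the series is dominated term by term by that of the real
  -- exponential at `‖X‖`.
  rw [← hasSum_nat_add_iff' 2] at h1 h2
  have h3 : ‖Real.exp ‖X‖ - 1 - ‖X‖‖ ≤ ‖‖X‖‖ ^ 2 :=
    Real.norm_exp_sub_one_sub_id_le (by rwa [norm_norm])
  rw [norm_norm] at h3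
  refine le_trans ?_ ((le_abs_self _).trans h3)
  simp only [Finset.sum_range_succ, Finset.range_zero, Finset.sum_empty, zero_add, Nat.factorial,
    Nat.cast_one, inv_one, pow_zero, pow_one, one_smul, mul_one, ← Real.exp_eq_exp_ℝ,
    ← sub_sub] at h1 h2
  have h4 := h1.norm_le_of_bounded h2 fun n => ?_
  · exact h4
  · rw [norm_smul, norm_inv, Complex.norm_natCast, smul_eq_mul]
    gcongr
    exact norm_pow_le' X (by omega)

open scoped Matrix.Norms.L2Operator

theorem Matrix.norm_le_one_of_mem_unitaryGroup {ι : Type} [Fintype ι] [DecidableEq ι]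
    {U : Matrix ι ι ℂ} (hU : U ∈ unitaryGroup ι ℂ) : ‖U‖ ≤ 1 := by
  rcases subsingleton_or_nontrivial (Matrix ι ι ℂ) with h | h
  · rw [Subsingleton.elim U 0, norm_zero]
    exact zero_le_one
  · exact (CStarRing.norm_of_mem_unitary hU).le

theorem Matrix.norm_conj_unitary {ι : Type} [Fintype ι] [DecidableEq ι]
    {U : Matrix ι ι ℂ} (hU : U ∈ unitaryGroup ι ℂ) (A : Matrix ι ι ℂ) : ‖Uᴴ * A * U‖ = ‖A‖ := by
  have hU' : Uᴴ ∈ unitary (Matrix ι ι ℂ) := Unitary.star_mem hU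
  rw [CStarRing.norm_mul_mem_unitary _ hU, CStarRing.norm_mem_unitary_mul _ hU']

/-- Second-order error of `Wᴴ A W ≈ A + Xᴴ A + A X` for `W ≈ 1 + X`. -/
theorem Matrix.norm_conj_sub_first_order_le {ι : Type} [Fintype ι] [DecidableEq ι]
    {W X A : Matrix ι ι ℂ} {x : ℝ} (hx : x ≤ 1) (hX : ‖X‖ ≤ x) (hR : ‖W - 1 - X‖ ≤ 2 * x ^ 2) :
    ‖Wᴴ * A * W - A - (Xᴴ * A + A * X)‖ ≤ 13 * x ^ 2 * ‖A‖ := by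
  have hx0 : 0 ≤ x := (norm_nonneg _).trans hX
  set R := W - 1 - X with hRdef
  have hD : ‖X + R‖ ≤ 3 * x := (norm_add_le _ _).trans (by nlinarith)
  -- With `W = 1 + X + R`, the three error terms contribute `2 + 2 + 9 = 13` multiples of `x² ‖A‖`.
  have h : Wᴴ * A * W - A - (Xᴴ * A + A * X) = Rᴴ * A + A * R + (X + R)ᴴ * A * (X + R) := by
    have : W = 1 + X + R := by rw [hRdef]; abel
    rw [this]
    simp only [conjTranspose_add, conjTranspose_one]
    noncomm_ring
  have h1 : ‖Rᴴ * A‖ ≤ 2 * x ^ 2 * ‖A‖ := by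
    refine (norm_mul_le _ _).trans ?_
    rw [l2_opNorm_conjTranspose]
    gcongr
  have h2 : ‖A * R‖ ≤ 2 * x ^ 2 * ‖A‖ := by
    refine (norm_mul_le _ _).trans ?_
    rw [mul_comm]
    gcongr
  have h3 : ‖(X + R)ᴴ * A * (X + R)‖ ≤ 3 * x * ‖A‖ * (3 * x) := by
    refine (norm_mul_le _ _).trans ?_
    gcongr
    refine (norm_mul_le _ _).trans ?_
    rw [l2_opNorm_conjTranspose]
    gcongr
  rw [h]
  refine (norm_add₃_le).trans ?_
  nlinarith

/-! ### Commutation signs and averaging over the reshaping set -/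

namespace HamLearn

/-- `1` if the Pauli matrices commute, `-1` if they anticommute. -/
def Pauli.sign (p q : Pauli) : ℤ := if p = .I ∨ q = .I ∨ p = q then 1 else -1

theorem Pauli.mat_conj (p q : Pauli) : p.mat * q.mat * p.mat = (p.sign q : ℂ) • q.mat := by
  cases p <;> cases q <;> ext i j <;> fin_cases i <;> fin_cases j <;>
    simp [Pauli.mat, Pauli.sign, Matrix.mul_apply, Fin.sum_univ_two]

theorem Pauli.sum_sign (p : Pauli) : ∑ q : Pauli, q.sign p = if p = .I then 4 else 0 := by
  cases p <;> decide

/-- Character orthogonality: modulo phases the Pauli matrices form a group, on which commutation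
signs are the characters. -/
theorem Pauli.sum_sign_mul_sign (p p' : Pauli) :
    ∑ q : Pauli, q.sign p * q.sign p' = if p = p' then 4 else 0 := by
  cases p <;> cases p' <;> decide

theorem Pauli.sign_eq (p q : Pauli) : p.sign q = 1 ∨ p.sign q = -1 := by
  unfold Pauli.sign
  split_ifs <;> simp

variable {n : ℕ}

/-- `1` if the Pauli operators commute, `-1` if they anticommute. -/
def PauliString.sign (P Q : PauliString n) : ℤ := ∏ j, (P j).sign (Q j)

theorem tensorOp_smul (c : Fin n → ℂ) (A : Fin n → Matrix (Fin 2) (Fin 2) ℂ) :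
    (tensorOp fun j => c j • A j) = (∏ j, c j) • tensorOp A := by
  ext a b
  simp [tensorOp, Finset.prod_mul_distrib]

theorem PauliString.op_conj (Q P : PauliString n) : Q.op * P.op * Q.op = (Q.sign P : ℂ) • P.op := by
  simp only [op, tensorOp_mul, Pauli.mat_conj, tensorOp_smul, sign, Int.cast_prod]

theorem PauliString.sign_eq (P Q : PauliString n) : P.sign Q = 1 ∨ P.sign Q = -1 := by
  unfold sign
  induction (Finset.univ : Finset (Fin n)) using Finset.cons_induction with
  | empty => simp
  | cons j s hj ih =>
    rw [Finset.prod_cons]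
    rcases (P j).sign_eq (Q j) with h | h <;> rcases ih with h' | h' <;> simp [h, h']

theorem PauliString.sum_sign (s : PauliString n) :
    ∑ Q : PauliString n, Q.sign s = if s = (fun _ => .I) then 4 ^ n else 0 := by
  simp only [sign]
  rw [← Fintype.piFinset_univ, ← Finset.prod_univ_sum (fun _ => Finset.univ)
    (fun j q => Pauli.sign q (s j))]
  simp only [Pauli.sum_sign, Finset.prod_ite_zero, funext_iff, Finset.mem_univ, true_imp_iff]
  simp

theorem PauliString.sum_sign_mul_sign (s s' : PauliString n) :
    ∑ Q : PauliString n, Q.sign s * Q.sign s' = if s = s' then 4 ^ n else 0 := by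
  simp only [sign, ← Finset.prod_mul_distrib]
  rw [← Fintype.piFinset_univ, ← Finset.prod_univ_sum (fun _ => Finset.univ)
    (fun j q => Pauli.sign q (s j) * Pauli.sign q (s' j))]
  simp only [Pauli.sum_sign_mul_sign, Finset.prod_ite_zero, funext_iff, Finset.mem_univ,
    true_imp_iff]
  simp

theorem PauliString.mem_reshapingSet_iff (s Q : PauliString n) :
    Q ∈ reshapingSet s ↔ Q.sign s = 1 := by
  have h : Q.op * s.op = s.op * Q.op ↔ Q.op * s.op * Q.op = s.op := by
    constructor
    · intro h
      rw [h, Matrix.mul_assoc, op_mul_self, mul_one]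
    · intro h
      rw [← congrArg (· * Q.op) h, Matrix.mul_assoc _ Q.op, op_mul_self, mul_one]
  rw [reshapingSet, Finset.mem_filter, h, op_conj]
  simp only [Finset.mem_univ, true_and]
  constructor
  · intro h1
    rcases Q.sign_eq s with h2 | h2
    · exact h2
    · exfalso
      rw [h2] at h1
      have h3 : s.op = 0 := by
        have : (2 : ℂ) • s.op = 0 := by
          nth_rw 1 [two_smul, ← h1]
          simp
        simpa using this
      have h4 := s.op_mul_self
      rw [h3, mul_zero] at h4
      exact zero_ne_one h4
  · intro h1
    simp [h1]

/-- The indicator of commuting with `P_s` is `(1 + sign) / 2`, which turns sums over the reshaping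
set into full character sums. -/
theorem PauliString.two_mul_sum_reshapingSet (s : PauliString n) (f : PauliString n → ℤ) :
    2 * ∑ Q ∈ reshapingSet s, f Q = ∑ Q, f Q + ∑ Q, f Q * Q.sign s := by
  classical
  have h : reshapingSet s = Finset.univ.filter fun Q => Q.sign s = 1 := by
    ext Q
    simp [mem_reshapingSet_iff]
  rw [h, Finset.sum_filter, Finset.mul_sum, ← Finset.sum_add_distrib]
  refine Finset.sum_congr rfl fun Q _ => ?_
  rcases Q.sign_eq s with h | h <;> simp [h, two_mul]

theorem PauliString.sum_reshapingSet_sign {s s' : PauliString n} (hs : s ≠ fun _ => .I)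
    (hs' : s' ≠ fun _ => .I) :
    ∑ Q ∈ reshapingSet s, Q.sign s' = if s' = s then ((reshapingSet s).card : ℤ) else 0 := by
  have h1 := s.two_mul_sum_reshapingSet fun Q => Q.sign s'
  have h2 := s.two_mul_sum_reshapingSet fun _ => 1
  simp only [one_mul, sum_sign, hs, hs', if_false, sum_sign_mul_sign] at h1 h2
  simp only [Finset.sum_const, nsmul_eq_mul, mul_one, Finset.card_univ, Fintype.card_fun,
    Fintype.card_fin] at h2
  have h3 : Fintype.card Pauli = 4 := rfl
  rw [h3] at h2
  push_cast at h2
  split_ifs at h1 ⊢ <;> omega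

/-- Averaging over the reshaping set leaves only the `P_s` term of a traceless Hamiltonian. -/
theorem sum_reshapingSet_conj_hamiltonian {μ : PauliString n → ℝ} (h0 : μ (fun _ => .I) = 0)
    {s : PauliString n} (hs : s ≠ fun _ => .I) :
    ∑ Q ∈ reshapingSet s, Q.op * hamiltonian μ * Q.op
      = ((reshapingSet s).card : ℂ) • (μ s : ℂ) • s.op := by
  have h1 : ∀ Q : PauliString n, Q.op * hamiltonian μ * Q.op
      = ∑ s', (μ s' : ℂ) • (Q.sign s' : ℂ) • s'.op := fun Q => by
    simp only [hamiltonian, Finset.mul_sum, Finset.sum_mul, mul_smul_comm, smul_mul_assoc,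
      PauliString.op_conj]
  simp only [h1]
  rw [Finset.sum_comm, Finset.sum_eq_single s]
  · rw [← Finset.smul_sum, ← Finset.sum_smul, ← Int.cast_sum,
      PauliString.sum_reshapingSet_sign hs hs, if_pos rfl, smul_comm]
    simp
  · intro s' _ hne
    -- The identity term would survive the averaging; it is absent because the Hamiltonian is
    -- traceless.
    by_cases hI : s' = fun _ => .I
    · simp [hI, h0]
    · rw [← Finset.smul_sum, ← Finset.sum_smul, ← Int.cast_sum,
        PauliString.sum_reshapingSet_sign hs hI, if_neg hne]
      simp
  · simp

theorem PauliString.norm_op_le (s : PauliString n) : ‖s.op‖ ≤ 1 :=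
  norm_le_one_of_mem_unitaryGroup s.unitary.2

theorem IsAdmissible.norm_hamiltonian_le {M : ℕ} {μ : PauliString n → ℝ} (h : IsAdmissible M μ) :
    ‖hamiltonian μ‖ ≤ M := by
  classical
  have h1 : ({s | μ s ≠ 0} : Set (PauliString n)).ncard
      = (Finset.univ.filter fun s => μ s ≠ 0).card := by
    rw [← Set.ncard_coe_finset]
    simp
  calc ‖hamiltonian μ‖ ≤ ∑ s, ‖(μ s : ℂ) • s.op‖ := norm_sum_le _ _
    _ ≤ ∑ s, if μ s ≠ 0 then 1 else 0 := by
      refine Finset.sum_le_sum fun s _ => ?_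
      split_ifs with hs
      · rw [norm_smul, Complex.norm_real]
        exact mul_le_one₀ (h.bounded s) (norm_nonneg _) s.norm_op_le
      · simp [not_not.1 hs]
    _ = ((Finset.univ.filter fun s => μ s ≠ 0).card : ℝ) := by
      rw [Finset.sum_boole]
    _ ≤ M := by
      rw [← h1]
      exact_mod_cast h.terms

/-! ### The target rotation and one averaged step -/

/-- The rotation `exp(-i θ P) = cos θ - i sin θ P`. -/
noncomputable def PauliString.rotation (s : PauliString n) (θ : ℝ) :
    Matrix (Qubits n) (Qubits n) ℂ :=
  (Real.cos θ : ℂ) • 1 - (Complex.I * (Real.sin θ : ℂ)) • s.op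

theorem PauliString.rotation_conjTranspose (s : PauliString n) (θ : ℝ) :
    (s.rotation θ)ᴴ = s.rotation (-θ) := by
  rw [rotation, rotation, conjTranspose_sub, conjTranspose_smul, conjTranspose_smul,
    s.op_conjTranspose, conjTranspose_one, Real.cos_neg, Real.sin_neg, RCLike.star_def,
    map_mul, Complex.conj_ofReal, Complex.conj_ofReal, Complex.conj_I]
  push_cast
  ring_nf

theorem PauliString.rotation_mul (s : PauliString n) (θ φ : ℝ) :
    s.rotation θ * s.rotation φ = s.rotation (θ + φ) := by
  simp only [rotation, sub_mul, mul_sub, smul_mul_assoc, mul_smul_comm, one_mul, mul_one,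
    s.op_mul_self, Real.cos_add, Real.sin_add]
  push_cast
  have := Complex.I_sq
  match_scalars
  · linear_combination (Complex.sin θ * Complex.sin φ) * this
  · ring

theorem PauliString.rotation_mem_unitaryGroup (s : PauliString n) (θ : ℝ) :
    s.rotation θ ∈ unitaryGroup (Qubits n) ℂ := by
  rw [mem_unitaryGroup_iff, star_eq_conjTranspose, rotation_conjTranspose, rotation_mul,
    add_neg_cancel]
  simp [rotation]

/-- The coefficients of the remainder, `cos θ - 1` and `sin θ - θ`, are the real and imaginary parts
of `exp(iθ) - 1 - iθ`, hence the factor `2`. -/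
theorem PauliString.norm_rotation_sub_le (s : PauliString n) {θ : ℝ} (hθ : |θ| ≤ 1) :
    ‖s.rotation θ - 1 - (-Complex.I * (θ : ℂ)) • s.op‖ ≤ 2 * |θ| ^ 2 := by
  have h1 : ‖Complex.exp ((θ : ℂ) * Complex.I) - 1 - (θ : ℂ) * Complex.I‖ ≤ |θ| ^ 2 := by
    have hn : ‖(θ : ℂ) * Complex.I‖ = |θ| := by simp
    rw [← hn]
    exact Complex.norm_exp_sub_one_sub_id_le (by rwa [hn])
  have hcos : |Real.cos θ - 1| ≤ |θ| ^ 2 := by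
    have := (Complex.abs_re_le_norm _).trans h1
    simpa [Complex.exp_ofReal_mul_I_re] using this
  have hsin : |Real.sin θ - θ| ≤ |θ| ^ 2 := by
    have := (Complex.abs_im_le_norm _).trans h1
    simpa [Complex.exp_ofReal_mul_I_im] using this
  have h2 : s.rotation θ - 1 - (-Complex.I * (θ : ℂ)) • s.op
      = ((Real.cos θ - 1 : ℝ) : ℂ) • 1 + (-Complex.I * ((Real.sin θ - θ : ℝ) : ℂ)) • s.op := by
    rw [rotation]
    push_cast
    module
  have hone : ‖(1 : Matrix (Qubits n) (Qubits n) ℂ)‖ ≤ 1 :=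
    norm_le_one_of_mem_unitaryGroup (one_mem _)
  rw [h2]
  refine (norm_add_le _ _).trans ?_
  rw [norm_smul, norm_smul, norm_mul, norm_neg, Complex.norm_I, one_mul, Complex.norm_real,
    Complex.norm_real, Real.norm_eq_abs, Real.norm_eq_abs]
  have := mul_le_mul hcos hone (norm_nonneg _) (by positivity)
  have := mul_le_mul hsin s.norm_op_le (norm_nonneg _) (by positivity)
  linarith

/-- One reshaped time step `Q e^{-iHτ} Q`. -/
noncomputable def pulsedStep (μ : PauliString n → ℝ) (τ : ℝ) (Q : PauliString n) :
    unitaryGroup (Qubits n) ℂ :=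
  Q.unitary * timeEvolution μ τ * Q.unitary

/-- Conjugation by `Q` is isometric and fixes `1`, so the estimates reduce to those for `exp(-iHτ)`
itself. -/
theorem norm_pulsedStep_sub_le {M : ℕ} {μ : PauliString n → ℝ} (h : IsAdmissible M μ) {τ : ℝ}
    (hτ : 0 ≤ τ) (hM : M * τ ≤ 1) (Q : PauliString n) :
    ‖(-Complex.I * (τ : ℂ)) • (Q.op * hamiltonian μ * Q.op)‖ ≤ M * τ ∧
    ‖(pulsedStep μ τ Q : Matrix (Qubits n) (Qubits n) ℂ) - 1
      - (-Complex.I * (τ : ℂ)) • (Q.op * hamiltonian μ * Q.op)‖ ≤ 2 * (M * τ) ^ 2 := by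
  have hconj : ∀ A : Matrix (Qubits n) (Qubits n) ℂ, ‖Q.op * A * Q.op‖ = ‖A‖ := fun A => by
    have := norm_conj_unitary Q.unitary.2 A
    rw [show (Q.unitary : Matrix (Qubits n) (Qubits n) ℂ) = Q.op from rfl,
      Q.op_conjTranspose] at this
    exact this
  have hX : ‖(-Complex.I * (τ : ℂ)) • hamiltonian μ‖ ≤ M * τ := by
    rw [norm_smul, norm_mul, norm_neg, Complex.norm_I, one_mul, Complex.norm_real,
      Real.norm_of_nonneg hτ, mul_comm]
    exact mul_le_mul_of_nonneg_right h.norm_hamiltonian_le hτ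
  constructor
  · rw [← smul_mul_assoc, ← mul_smul_comm, hconj]
    exact hX
  · have h1 : (pulsedStep μ τ Q : Matrix (Qubits n) (Qubits n) ℂ) - 1
        - (-Complex.I * (τ : ℂ)) • (Q.op * hamiltonian μ * Q.op)
        = Q.op * (NormedSpace.exp ((-Complex.I * (τ : ℂ)) • hamiltonian μ) - 1
          - (-Complex.I * (τ : ℂ)) • hamiltonian μ) * Q.op := by
      have h2 : (pulsedStep μ τ Q : Matrix (Qubits n) (Qubits n) ℂ)
          = Q.op * NormedSpace.exp ((-Complex.I * (τ : ℂ)) • hamiltonian μ) * Q.op := rfl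
      rw [h2]
      simp only [mul_sub, sub_mul, mul_one, Q.op_mul_self, mul_smul_comm, smul_mul_assoc]
    rw [h1, hconj]
    refine (NormedSpace.norm_exp_sub_one_sub_id_le (hX.trans hM)).trans ?_
    have := pow_le_pow_left₀ (norm_nonneg _) hX 2
    nlinarith [sq_nonneg ((M : ℝ) * τ)]

/-- The average of `Wᴴ A W` over the reshaped time steps `W`. -/
noncomputable def averagedStep (μ : PauliString n → ℝ) (s : PauliString n) (τ : ℝ)
    (A : Matrix (Qubits n) (Qubits n) ℂ) : Matrix (Qubits n) (Qubits n) ℂ :=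
  ((reshapingSet s).card : ℂ)⁻¹ • ∑ Q ∈ reshapingSet s,
    (pulsedStep μ τ Q : Matrix (Qubits n) (Qubits n) ℂ)ᴴ * A * pulsedStep μ τ Q

theorem norm_average_le {α : Type} (S : Finset α) (f : α → Matrix (Qubits n) (Qubits n) ℂ) {c : ℝ}
    (hc : 0 ≤ c) (hf : ∀ a ∈ S, ‖f a‖ ≤ c) : ‖(S.card : ℂ)⁻¹ • ∑ a ∈ S, f a‖ ≤ c := by
  rw [norm_smul, norm_inv, Complex.norm_natCast]
  rcases S.eq_empty_or_nonempty with h | h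
  · simpa [h] using hc
  · rw [inv_mul_le_iff₀ (by exact_mod_cast h.card_pos), ← nsmul_eq_mul]
    exact (norm_sum_le _ _).trans (Finset.sum_le_card_nsmul _ _ _ hf)

theorem norm_averagedStep_le (μ : PauliString n → ℝ) (s : PauliString n) (τ : ℝ)
    (A : Matrix (Qubits n) (Qubits n) ℂ) : ‖averagedStep μ s τ A‖ ≤ ‖A‖ :=
  norm_average_le _ _ (norm_nonneg _) fun Q _ => (norm_conj_unitary (pulsedStep μ τ Q).2 A).le

/-- The first-order terms of the pulsed steps average exactly to the first-order term of the
rotation. Only the two second-order remainders are left, `13` each. -/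
theorem norm_averagedStep_sub_le {M : ℕ} {μ : PauliString n → ℝ} (h : IsAdmissible M μ)
    {s : PauliString n} (hs : s ≠ fun _ => .I) (hM1 : 1 ≤ M) {τ : ℝ} (hτ : 0 ≤ τ)
    (hM : M * τ ≤ 1) (A : Matrix (Qubits n) (Qubits n) ℂ) :
    ‖averagedStep μ s τ A - (s.rotation (μ s * τ))ᴴ * A * s.rotation (μ s * τ)‖
      ≤ 26 * (M * τ) ^ 2 * ‖A‖ := by
  have hcard : ((reshapingSet s).card : ℂ) ≠ 0 := by
    exact_mod_cast (reshapingSet_nonempty s).card_pos.ne'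
  set X : PauliString n → Matrix (Qubits n) (Qubits n) ℂ :=
    fun Q => (-Complex.I * (τ : ℂ)) • (Q.op * hamiltonian μ * Q.op) with hXdef
  set Y : Matrix (Qubits n) (Qubits n) ℂ := (-Complex.I * ((μ s * τ : ℝ) : ℂ)) • s.op with hYdef
  set V := s.rotation (μ s * τ)
  have havg : ((reshapingSet s).card : ℂ)⁻¹ • ∑ Q ∈ reshapingSet s, X Q = Y := by
    rw [hXdef, ← Finset.smul_sum, sum_reshapingSet_conj_hamiltonian h.traceless hs,
      smul_comm, inv_smul_smul₀ hcard, hYdef, smul_smul]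
    push_cast
    ring_nf
  have havg' : ((reshapingSet s).card : ℂ)⁻¹ • ∑ Q ∈ reshapingSet s, (X Q)ᴴ = Yᴴ := by
    rw [← havg, conjTranspose_smul, conjTranspose_sum]
    simp
  have hμτ : |μ s * τ| ≤ M * τ := by
    rw [abs_mul, abs_of_nonneg hτ]
    refine mul_le_mul_of_nonneg_right ((h.bounded s).trans ?_) hτ
    -- Here `|μ s| ≤ 1 ≤ M` lets one bound `M τ` control both expansions.
    exact_mod_cast hM1
  have hYb : ‖Vᴴ * A * V - A - (Yᴴ * A + A * Y)‖ ≤ 13 * (M * τ) ^ 2 * ‖A‖ := by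
    refine norm_conj_sub_first_order_le hM ?_ ?_
    · rw [hYdef, norm_smul, norm_mul, norm_neg, Complex.norm_I, one_mul, Complex.norm_real,
        Real.norm_eq_abs]
      exact (mul_le_of_le_one_right (abs_nonneg _) s.norm_op_le).trans hμτ
    · refine (s.norm_rotation_sub_le (hμτ.trans hM)).trans ?_
      gcongr
  have hXb : ‖((reshapingSet s).card : ℂ)⁻¹ • ∑ Q ∈ reshapingSet s,
      ((pulsedStep μ τ Q : Matrix (Qubits n) (Qubits n) ℂ)ᴴ * A * pulsedStep μ τ Q - A
        - ((X Q)ᴴ * A + A * X Q))‖ ≤ 13 * (M * τ) ^ 2 * ‖A‖ :=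
    norm_average_le _ _ (by positivity) fun Q _ =>
      norm_conj_sub_first_order_le hM (norm_pulsedStep_sub_le h hτ hM Q).1
        (norm_pulsedStep_sub_le h hτ hM Q).2
  have hsplit : averagedStep μ s τ A - Vᴴ * A * V
      = ((reshapingSet s).card : ℂ)⁻¹ • ∑ Q ∈ reshapingSet s,
      ((pulsedStep μ τ Q : Matrix (Qubits n) (Qubits n) ℂ)ᴴ * A * pulsedStep μ τ Q - A
        - ((X Q)ᴴ * A + A * X Q)) - (Vᴴ * A * V - A - (Yᴴ * A + A * Y)) := by
    have hA : ((reshapingSet s).card : ℂ)⁻¹ • ∑ _Q ∈ reshapingSet s, A = A := by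
      rw [Finset.sum_const, ← Nat.cast_smul_eq_nsmul ℂ, inv_smul_smul₀ hcard]
    have hAX : ((reshapingSet s).card : ℂ)⁻¹ • ∑ Q ∈ reshapingSet s, A * X Q = A * Y := by
      rw [← Finset.mul_sum, ← mul_smul_comm, havg]
    have hXA : ((reshapingSet s).card : ℂ)⁻¹ • ∑ Q ∈ reshapingSet s, (X Q)ᴴ * A = Yᴴ * A := by
      rw [← Finset.sum_mul, ← smul_mul_assoc, havg']
    simp only [Finset.sum_sub_distrib, Finset.sum_add_distrib, smul_sub, smul_add, hA, hAX, hXA]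
    rw [averagedStep]
    abel
  rw [hsplit]
  refine (norm_sub_le _ _).trans ?_
  linarith

/-! ### Iterating the averaged step -/

theorem sum_piFinset_succ {α β : Type*} [AddCommMonoid β] [DecidableEq α] (S : Finset α) (r : ℕ)
    (f : (Fin (r + 1) → α) → β) :
    ∑ Q ∈ Fintype.piFinset (fun _ : Fin (r + 1) => S), f Q
      = ∑ q ∈ S, ∑ Q ∈ Fintype.piFinset (fun _ : Fin r => S), f (Fin.cons q Q) := by
  rw [← Finset.sum_product']
  refine Finset.sum_nbij' (fun Q => (Q 0, Fin.tail Q)) (fun p => Fin.cons p.1 p.2) ?_ ?_ ?_ ?_ ?_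
  · intro Q hQ
    rw [Fintype.mem_piFinset] at hQ
    exact Finset.mem_product.2 ⟨hQ 0, Fintype.mem_piFinset.2 fun i => hQ i.succ⟩
  · rintro ⟨q, Q⟩ hQ
    obtain ⟨h1, h2⟩ := Finset.mem_product.1 hQ
    rw [Fintype.mem_piFinset] at h2 ⊢
    exact Fin.cases h1 h2
  · simp
  · simp
  · simp

theorem reshapedEvolution_cons {r : ℕ} (μ : PauliString n → ℝ) (τ : ℝ) (q : PauliString n)
    (Q : Fin r → PauliString n) :
    reshapedEvolution μ τ (Fin.cons q Q : Fin (r + 1) → PauliString n)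
      = reshapedEvolution μ τ Q * pulsedStep μ τ q := by
  simp [reshapedEvolution, List.ofFn_succ, pulsedStep]

/-- The first pulse is the rightmost factor, hence the outermost conjugation in the Heisenberg
picture. Independence of the pulses factorizes the average into successive one-step averages. -/
theorem average_reshapedEvolution (μ : PauliString n → ℝ) (s : PauliString n) (τ : ℝ) (r : ℕ)
    (A : Matrix (Qubits n) (Qubits n) ℂ) :
    ((Fintype.piFinset fun _ : Fin r => reshapingSet s).card : ℂ)⁻¹ •
      ∑ Q ∈ Fintype.piFinset fun _ : Fin r => reshapingSet s,
        (reshapedEvolution μ τ Q : Matrix (Qubits n) (Qubits n) ℂ)ᴴ * A * reshapedEvolution μ τ Q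
      = (averagedStep μ s τ)^[r] A := by
  induction r with
  | zero => simp [reshapedEvolution]
  | succ r ih =>
    have h : ∀ U W : unitaryGroup (Qubits n) ℂ, ((U * W : unitaryGroup (Qubits n) ℂ) :
        Matrix (Qubits n) (Qubits n) ℂ)ᴴ * A * (U * W : unitaryGroup (Qubits n) ℂ)
        = (W : Matrix (Qubits n) (Qubits n) ℂ)ᴴ * ((U : Matrix (Qubits n) (Qubits n) ℂ)ᴴ * A * U)
          * W := fun U W => by
      rw [UnitaryGroup.mul_val, conjTranspose_mul]
      simp only [Matrix.mul_assoc]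
    rw [Function.iterate_succ_apply', ← ih, sum_piFinset_succ, averagedStep]
    simp only [reshapedEvolution_cons, h, ← Finset.mul_sum, ← Finset.sum_mul, mul_smul_comm,
      smul_mul_assoc, ← Finset.smul_sum, smul_smul]
    rw [Fintype.card_piFinset_const, Fintype.card_piFinset_const, pow_succ]
    push_cast
    rw [mul_inv, mul_comm]

theorem norm_iterate_averagedStep_le (μ : PauliString n → ℝ) (s : PauliString n) (τ : ℝ) (r : ℕ)
    (A : Matrix (Qubits n) (Qubits n) ℂ) : ‖(averagedStep μ s τ)^[r] A‖ ≤ ‖A‖ := by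
  induction r with
  | zero => simp
  | succ r ih =>
    rw [Function.iterate_succ_apply']
    exact (norm_averagedStep_le _ _ _ _).trans ih

/-- Hamiltonian reshaping: on average over the pulses, the evolution of an observable is that under
`μ_s P_s`, up to an error of second order in the step. -/
theorem norm_iterate_averagedStep_sub_le {M : ℕ} {μ : PauliString n → ℝ} (h : IsAdmissible M μ)
    {s : PauliString n} (hs : s ≠ fun _ => .I) (hM1 : 1 ≤ M) {τ : ℝ} (hτ : 0 ≤ τ)
    (hM : M * τ ≤ 1) (A : Matrix (Qubits n) (Qubits n) ℂ) (r : ℕ) :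
    ‖(averagedStep μ s τ)^[r] A
      - (s.rotation (r * (μ s * τ)))ᴴ * A * s.rotation (r * (μ s * τ))‖
      ≤ r * (26 * (M * τ) ^ 2 * ‖A‖) := by
  induction r with
  | zero => simp [PauliString.rotation]
  | succ r ih =>
    rw [Function.iterate_succ_apply']
    set B := (averagedStep μ s τ)^[r] A
    set V := s.rotation (μ s * τ) with hV
    set U := s.rotation (r * (μ s * τ)) with hU
    have hUV : s.rotation ((r + 1 : ℕ) * (μ s * τ)) = U * V := by
      rw [hU, hV, PauliString.rotation_mul]
      push_cast
      ring_nf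
    -- The error splits into the new step's error on `B` and the old error conjugated by a unitary;
    -- since `‖B‖ ≤ ‖A‖`, errors add linearly in `r`.
    have h1 : averagedStep μ s τ B - (U * V)ᴴ * A * (U * V)
        = (averagedStep μ s τ B - Vᴴ * B * V) + Vᴴ * (B - Uᴴ * A * U) * V := by
      rw [conjTranspose_mul]
      simp only [mul_sub, sub_mul, Matrix.mul_assoc]
      abel
    have h2 := norm_averagedStep_sub_le h hs hM1 hτ hM B
    have h3 : 26 * (M * τ) ^ 2 * ‖B‖ ≤ 26 * (M * τ) ^ 2 * ‖A‖ := by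
      gcongr
      exact norm_iterate_averagedStep_le μ s τ r A
    rw [hUV, h1]
    refine (norm_add_le _ _).trans ?_
    rw [norm_conj_unitary (s.rotation_mem_unitaryGroup _)]
    push_cast
    linarith

/-! ### Mean outcome of one experiment -/

theorem tensorVec_expectation (A : Fin n → Matrix (Fin 2) (Fin 2) ℂ) (v : Fin n → Fin 2 → ℂ) :
    star (tensorVec v) ⬝ᵥ (tensorOp A *ᵥ tensorVec v) = ∏ j, star (v j) ⬝ᵥ (A j *ᵥ v j) := by
  have h : tensorOp A *ᵥ tensorVec v = tensorVec fun j => A j *ᵥ v j := by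
    ext a
    simp only [Matrix.mulVec, dotProduct, tensorVec, tensorOp, Matrix.of_apply,
      ← Finset.prod_mul_distrib]
    rw [Finset.prod_univ_sum, Fintype.piFinset_univ]
  rw [h]
  simp only [dotProduct, tensorVec, Pi.star_apply, star_prod, ← Finset.prod_mul_distrib]
  rw [Finset.prod_univ_sum, Fintype.piFinset_univ]

theorem superposition_expectation {β : Pauli} (hβ : β ≠ .I) :
    star (superposition β) ⬝ᵥ (probeObs true β *ᵥ superposition β) = 1 ∧
    star (superposition β) ⬝ᵥ (probeObs false β *ᵥ superposition β) = 0 ∧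
    star (superposition β) ⬝ᵥ ((β.mat * probeObs true β) *ᵥ superposition β) = 0 ∧
    star (superposition β) ⬝ᵥ ((β.mat * probeObs false β) *ᵥ superposition β) = -Complex.I := by
  have h2 := sqrt_two_mul_self
  have h0 : ((√2 : ℝ) : ℂ) ≠ 0 := by
    intro h
    rw [h] at h2
    norm_num at h2
  have hinv : ((√2 : ℝ) : ℂ)⁻¹ * ((√2 : ℝ) : ℂ)⁻¹ = 1 / 2 := by
    rw [← mul_inv, h2]
    norm_num
  -- With these phase conventions the probe state is `|0⟩` for `x` and `y`, and `|+⟩` for `z`.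
  have hx : superposition .x = ![1, 0] := by
    ext i
    fin_cases i
    · simp [superposition, ket]
      linear_combination 2 * hinv
    · simp [superposition, ket]
  have hy : superposition .y = ![1, 0] := by
    ext i
    fin_cases i
    · simp [superposition, ket]
      linear_combination 2 * hinv
    · simp [superposition, ket]
  have hz : superposition .z = ![((√2 : ℝ) : ℂ)⁻¹, ((√2 : ℝ) : ℂ)⁻¹] := by
    ext i
    fin_cases i <;> simp [superposition, ket]
  cases β
  · exact absurd rfl hβ
  · rw [hx]
    simp [probeObs, Pauli.mat, Matrix.mulVec, dotProduct, Fin.sum_univ_two]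
  · rw [hy]
    simp [probeObs, Pauli.mat, Matrix.mulVec, dotProduct, Fin.sum_univ_two]
  · rw [hz]
    refine ⟨?_, ?_, ?_, ?_⟩ <;>
      simp [probeObs, Pauli.mat, Matrix.mulVec, dotProduct, Fin.sum_univ_two] <;>
      first
        | linear_combination (2 : ℂ) * hinv
        | linear_combination (-2 * Complex.I) * hinv

theorem ket_true_expectation (β : Pauli) :
    star (ket true β) ⬝ᵥ (β.mat *ᵥ ket true β) = 1 := by
  have h : β.mat *ᵥ ket true β = ket true β := by
    have hI := Complex.I_mul_I
    cases β <;> simp only [Pauli.mat, ket, one_mulVec] <;> ext i <;> fin_cases i <;>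
      simp [Matrix.mulVec, dotProduct, Fin.sum_univ_two]
    · linear_combination (-((√2 : ℝ) : ℂ)⁻¹) * hI
    · ring
  rw [h, ket_norm]

/-- The factors anticommute on qubit `j` and commute on every other qubit, so exactly one sign
appears. -/
theorem op_mul_observable (b : Bool) {s : PauliString n} {j : Fin n} (hj : s j ≠ .I) :
    s.op * observable b s j = -(observable b s j * s.op) := by
  have h1 : ∀ i, (s i).mat * (if i = j then probeObs b (s i) else 1)
      = (if i = j then (-1 : ℂ) else 1) • ((if i = j then probeObs b (s i) else 1) * (s i).mat) := by
    intro i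
    by_cases h : i = j
    · subst h
      simp only [if_true]
      revert hj
      cases s i <;> cases b <;> intro hj <;> first | exact absurd rfl hj | skip
      all_goals
        ext a c
        fin_cases a <;> fin_cases c <;>
          simp [probeObs, Pauli.mat, Matrix.mul_apply, Fin.sum_univ_two]
    · simp [h]
  rw [observable, PauliString.op, tensorOp_mul, tensorOp_mul]
  simp only [h1]
  rw [tensorOp_smul]
  simp

/-- The expectation of `O_s^±` after the rotation by `θ` is `cos 2θ`, resp. `sin 2θ`. -/
theorem expectation_rotation (b : Bool) {s : PauliString n} {j : Fin n} (hj : s j ≠ .I) (θ : ℝ) :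
    star (probeVec s j) ⬝ᵥ
        (((s.rotation θ)ᴴ * observable b s j * s.rotation θ) *ᵥ probeVec s j)
      = ((if b then Real.cos (2 * θ) else Real.sin (2 * θ) : ℝ) : ℂ) := by
  -- Anticommutation turns the rotation into its adjoint as it passes the observable, so the two
  -- rotations combine and the angle doubles.
  have h1 : observable b s j * s.rotation θ = (s.rotation θ)ᴴ * observable b s j := by
    rw [s.rotation_conjTranspose, PauliString.rotation, PauliString.rotation, mul_sub, sub_mul,
      mul_smul_comm, mul_smul_comm, smul_mul_assoc, smul_mul_assoc, op_mul_observable b hj,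
      mul_one, one_mul, Real.cos_neg, Real.sin_neg]
    push_cast
    module
  have h2 : (s.rotation θ)ᴴ * observable b s j * s.rotation θ
      = (Real.cos (2 * θ) : ℂ) • observable b s j
        + (Complex.I * (Real.sin (2 * θ) : ℂ)) • (s.op * observable b s j) := by
    rw [Matrix.mul_assoc, h1, ← Matrix.mul_assoc, s.rotation_conjTranspose, s.rotation_mul,
      PauliString.rotation, sub_mul, smul_mul_assoc, smul_mul_assoc, one_mul,
      show -θ + -θ = -(2 * θ) by ring, Real.cos_neg, Real.sin_neg]
    push_cast
    module
  have hO : star (probeVec s j) ⬝ᵥ (observable b s j *ᵥ probeVec s j)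
      = star (superposition (s j)) ⬝ᵥ (probeObs b (s j) *ᵥ superposition (s j)) := by
    rw [probeVec, observable, tensorVec_expectation, Finset.prod_eq_single j]
    · simp
    · intro i _ hi
      simp only [hi, if_false, one_mulVec, ket_norm]
    · simp
  have hPO : star (probeVec s j) ⬝ᵥ ((s.op * observable b s j) *ᵥ probeVec s j)
      = star (superposition (s j)) ⬝ᵥ (((s j).mat * probeObs b (s j)) *ᵥ superposition (s j)) := by
    rw [probeVec, observable, PauliString.op, tensorOp_mul, tensorVec_expectation,
      Finset.prod_eq_single j]
    · simp
    · intro i _ hi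
      simp only [hi, if_false, mul_one]
      exact ket_true_expectation _
    · simp
  rw [h2, Matrix.add_mulVec, Matrix.smul_mulVec, Matrix.smul_mulVec, dotProduct_add,
    dotProduct_smul, dotProduct_smul, hO, hPO]
  obtain ⟨e1, e2, e3, e4⟩ := superposition_expectation hj
  cases b
  · rw [e2, e4]
    simp only [smul_eq_mul, Bool.false_eq_true, if_false]
    linear_combination (-(Real.sin (2 * θ) : ℂ)) * Complex.I_sq
  · rw [e1, e3]
    simp

theorem norm_expectation_le {ι : Type} [Fintype ι] [DecidableEq ι] (A : Matrix ι ι ℂ) {v : ι → ℂ}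
    (hv : star v ⬝ᵥ v = 1) : ‖star v ⬝ᵥ (A *ᵥ v)‖ ≤ ‖A‖ := by
  set w : EuclideanSpace ℂ ι := WithLp.toLp 2 v with hw
  have h1 : ‖w‖ = 1 := by
    have h : (inner ℂ w w : ℂ) = 1 := by
      rw [EuclideanSpace.inner_eq_star_dotProduct, ← hv, dotProduct_comm]
    rw [inner_self_eq_norm_sq_to_K] at h
    have h' : ‖w‖ ^ 2 = 1 := by
      have := congrArg Complex.re h
      simpa [← Complex.ofReal_pow] using this
    nlinarith [norm_nonneg w]
  have h2 : star v ⬝ᵥ (A *ᵥ v) = inner ℂ w (WithLp.toLp 2 (A *ᵥ v)) := by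
    rw [EuclideanSpace.inner_eq_star_dotProduct, dotProduct_comm]
  rw [h2]
  refine (norm_inner_le_norm _ _).trans ?_
  rw [h1, one_mul]
  have := A.l2_opNorm_mulVec w
  rwa [h1, mul_one] at this

theorem bornProb_sub {ι : Type} [Fintype ι] [DecidableEq ι] (O : Matrix ι ι ℂ)
    (ρ : DensityMatrix ι) :
    bornProb O ρ true - bornProb O ρ false = (O * ρ.mat).trace.re := by
  unfold bornProb
  rw [← Complex.sub_re, ← trace_sub, ← sub_mul]
  congr 3
  simp only [if_true, Bool.false_eq_true, if_false]
  module

theorem trace_mul_evolve_pureState {ι : Type} [Fintype ι] [DecidableEq ι] (O : Matrix ι ι ℂ)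
    (U : unitaryGroup ι ℂ) {v : ι → ℂ} (hv : star v ⬝ᵥ v = 1) :
    (O * ((pureState v hv).evolve U).mat).trace
      = star v ⬝ᵥ (((U : Matrix ι ι ℂ)ᴴ * O * (U : Matrix ι ι ℂ)) *ᵥ v) := by
  have h : (O * ((pureState v hv).evolve U).mat).trace
      = (((U : Matrix ι ι ℂ)ᴴ * O * (U : Matrix ι ι ℂ)) * vecMulVec v (star v)).trace := by
    rw [DensityMatrix.evolve, pureState, ← Matrix.mul_assoc, trace_mul_comm]
    simp only [Matrix.mul_assoc]
  rw [h, mul_vecMulVec, trace_vecMulVec, dotProduct_comm]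

/-- The numerical value of a `±1` outcome. -/
def spin (b : Bool) : ℝ := if b then 1 else -1

theorem integral_spin (p : PMF Bool) :
    ∫ x, spin x ∂p.toMeasure = (p true).toReal - (p false).toReal := by
  rw [PMF.integral_eq_sum, Fintype.sum_bool]
  simp [spin, sub_eq_add_neg]

theorem phaseExperiment_toReal {ε : ℝ} (μ : PauliString n → ℝ) (s : PauliString n) (j : Fin n)
    (hj : s j ≠ .I) (noise : SPAMNoise (Qubits n) ε) (b : Bool) (r : ℕ) (τ : ℝ) (x : Bool) :
    (phaseExperiment μ s j hj noise b r τ x).toReal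
      = ((Fintype.piFinset fun _ : Fin r => reshapingSet s).card : ℝ)⁻¹ *
        ∑ Q ∈ Fintype.piFinset fun _ : Fin r => reshapingSet s,
          bornProb (observable b s j) (noise.meas.apply
            ((noise.prep.apply (pureState (probeVec s j) (probeVec_norm s j hj))).evolve
              (reshapedEvolution μ τ Q))) x := by
  rw [phaseExperiment, PMF.bind_apply, tsum_fintype, ENNReal.toReal_sum
    (fun Q _ => ENNReal.mul_ne_top (PMF.apply_ne_top _ _) (PMF.apply_ne_top _ _)), Finset.mul_sum]
  rw [← Finset.sum_subset (Finset.subset_univ (Fintype.piFinset fun _ : Fin r => reshapingSet s))]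
  · refine Finset.sum_congr rfl fun Q hQ => ?_
    rw [ENNReal.toReal_mul, PMF.uniformOfFinset_apply_of_mem _ hQ, ENNReal.toReal_inv,
      ENNReal.toReal_natCast, measure, PMF.ofFintype_apply, ENNReal.toReal_ofReal]
    exact bornProb_nonneg (observable_isHermitian b s j) (observable_mul_self b s j) _ _
  · intro Q _ hQ
    rw [PMF.uniformOfFinset_apply_of_notMem _ hQ, zero_mul, ENNReal.toReal_zero]

/-- The mean outcome of a phase estimation experiment. -/
theorem abs_integral_phaseExperiment_sub_le {M : ℕ} {μ : PauliString n → ℝ}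
    (h : IsAdmissible M μ) (hM1 : 1 ≤ M) (s : PauliString n) (j : Fin n) (hj : s j ≠ .I) {ε : ℝ}
    (hε : 0 ≤ ε) (noise : SPAMNoise (Qubits n) ε) (b : Bool) (r : ℕ) {τ : ℝ} (hτ : 0 ≤ τ)
    (hM : M * τ ≤ 1) :
    |∫ x, spin x ∂(phaseExperiment μ s j hj noise b r τ).toMeasure
        - (if b then Real.cos (2 * μ s * (r * τ)) else Real.sin (2 * μ s * (r * τ)))|
      ≤ ε + r * (26 * (M * τ) ^ 2) := by
  set S := Fintype.piFinset fun _ : Fin r => reshapingSet s with hS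
  set O := observable b s j with hO
  set ψ := probeVec s j with hψ
  have hψ1 : star ψ ⬝ᵥ ψ = 1 := probeVec_norm s j hj
  have hOu : O ∈ unitaryGroup (Qubits n) ℂ := by
    rw [mem_unitaryGroup_iff, star_eq_conjTranspose, observable_isHermitian b s j,
      observable_mul_self]
  have hs : s ≠ fun _ => .I := fun hs => hj (by rw [hs])
  have hSne : S.Nonempty := Fintype.piFinset_nonempty.2 fun _ => reshapingSet_nonempty s
  have hSc : (0 : ℝ) < S.card := by exact_mod_cast hSne.card_pos
  set σ : (Fin r → PauliString n) → DensityMatrix (Qubits n) := fun Q => noise.meas.apply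
    ((noise.prep.apply (pureState ψ hψ1)).evolve (reshapedEvolution μ τ Q)) with hσ
  set B : (Fin r → PauliString n) → Matrix (Qubits n) (Qubits n) ℂ := fun Q =>
    (reshapedEvolution μ τ Q : Matrix (Qubits n) (Qubits n) ℂ)ᴴ * O * reshapedEvolution μ τ Q
    with hB
  have hmean : ∫ x, spin x ∂(phaseExperiment μ s j hj noise b r τ).toMeasure
      = (S.card : ℝ)⁻¹ * ∑ Q ∈ S, (O * (σ Q).mat).trace.re := by
    rw [integral_spin, phaseExperiment_toReal, phaseExperiment_toReal, ← mul_sub,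
      ← Finset.sum_sub_distrib]
    congr 1
    exact Finset.sum_congr rfl fun Q _ => bornProb_sub _ _
  -- The SPAM bound holds for each fixed pulse sequence, hence for the average.
  have hspam : |(S.card : ℝ)⁻¹ * ∑ Q ∈ S, (O * (σ Q).mat).trace.re
      - (S.card : ℝ)⁻¹ * ∑ Q ∈ S, (star ψ ⬝ᵥ (B Q *ᵥ ψ)).re| ≤ ε := by
    rw [← mul_sub, ← Finset.sum_sub_distrib, abs_mul, abs_of_pos (inv_pos.2 hSc),
      inv_mul_le_iff₀ hSc, ← nsmul_eq_mul]
    refine (Finset.abs_sum_le_sum_abs _ _).trans (Finset.sum_le_card_nsmul _ _ _ fun Q _ => ?_)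
    rw [← Complex.sub_re, ← trace_mul_evolve_pureState O _ hψ1]
    exact (Complex.abs_re_le_norm _).trans (noise.norm_trace_sub_le hε hOu _ _)
  have havg : (S.card : ℝ)⁻¹ * ∑ Q ∈ S, (star ψ ⬝ᵥ (B Q *ᵥ ψ)).re
      = (star ψ ⬝ᵥ (((averagedStep μ s τ)^[r] O) *ᵥ ψ)).re := by
    rw [← average_reshapedEvolution, Matrix.smul_mulVec, Matrix.sum_mulVec, dotProduct_smul,
      dotProduct_sum, smul_eq_mul, ← Complex.ofReal_natCast, ← Complex.ofReal_inv,
      Complex.re_ofReal_mul, Complex.re_sum]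
  have hresh : |(star ψ ⬝ᵥ (((averagedStep μ s τ)^[r] O) *ᵥ ψ)).re
      - (if b then Real.cos (2 * μ s * (r * τ)) else Real.sin (2 * μ s * (r * τ)))|
      ≤ r * (26 * (M * τ) ^ 2) := by
    have h1 := expectation_rotation b hj (r * (μ s * τ))
    rw [show 2 * (r * (μ s * τ)) = 2 * μ s * (r * τ) by ring] at h1
    have h2 := norm_expectation_le ((averagedStep μ s τ)^[r] O
      - (s.rotation (r * (μ s * τ)))ᴴ * O * s.rotation (r * (μ s * τ))) hψ1
    rw [Matrix.sub_mulVec, dotProduct_sub, h1] at h2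
    have h3 := (Complex.abs_re_le_norm _).trans
      (h2.trans (norm_iterate_averagedStep_sub_le h hs hM1 hτ hM O r))
    rw [Complex.sub_re, Complex.ofReal_re] at h3
    refine h3.trans (mul_le_mul_of_nonneg_left ?_ (Nat.cast_nonneg r))
    exact mul_le_of_le_one_right (by positivity) (norm_le_one_of_mem_unitaryGroup hOu)
  rw [hmean, ← sub_add_sub_cancel _ ((S.card : ℝ)⁻¹ * ∑ Q ∈ S, (star ψ ⬝ᵥ (B Q *ᵥ ψ)).re)]
  refine (abs_add_le _ _).trans (add_le_add hspam ?_)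
  rw [havg]
  exact hresh

end HamLearn

/-! ### Concentration of block averages -/

open MeasureTheory ProbabilityTheory

namespace HamLearn

/-- Hoeffding's inequality for functions of independent Boolean variables with different laws. -/
theorem measure_pi_bool_sum_ge_le {ι : Type} [Fintype ι] (p : ι → PMF Bool) (f : Bool → ℝ)
    (hf : ∀ x, f x ∈ Set.Icc (-1 : ℝ) 1) (S : Finset ι) {δ : ℝ} (hδ : 0 ≤ δ) :
    (Measure.pi fun l => (p l).toMeasure).real
        {ν | S.card * δ ≤ ∑ l ∈ S, (f (ν l) - ∫ x, f x ∂(p l).toMeasure)}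
      ≤ Real.exp (-(S.card * δ ^ 2 / 2)) := by
  have hind : iIndepFun (fun l (ν : ι → Bool) => f (ν l) - ∫ x, f x ∂(p l).toMeasure)
      (Measure.pi fun l => (p l).toMeasure) :=
    iIndepFun_pi (X := fun l x => f x - ∫ x, f x ∂(p l).toMeasure)
      fun l => (measurable_of_finite _).aemeasurable
  have hsub : ∀ l ∈ S, HasSubgaussianMGF
      (fun ν : ι → Bool => f (ν l) - ∫ x, f x ∂(p l).toMeasure) 1
      (Measure.pi fun l => (p l).toMeasure) := fun l _ => by
    have h := hasSubgaussianMGF_of_mem_Icc (μ := Measure.pi fun l => (p l).toMeasure)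
      (X := fun ν : ι → Bool => f (ν l)) (a := -1) (b := 1)
      (measurable_of_finite _).aemeasurable (Filter.Eventually.of_forall fun ν => hf (ν l))
    have h2 : ∫ ν, f (ν l) ∂(Measure.pi fun l => (p l).toMeasure)
        = ∫ x, f x ∂(p l).toMeasure :=
      integral_comp_eval (μ := fun l => (p l).toMeasure) (f := f)
        (measurable_of_finite f).aestronglyMeasurable
    -- Hoeffding's lemma gives variance proxy `((1 - (-1)) / 2)² = 1` for values in `[-1, 1]`.
    have h3 : ((‖(1 : ℝ) - -1‖₊ / 2) ^ 2 : NNReal) = 1 := by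
      apply NNReal.coe_injective
      norm_num
    rwa [h2, h3] at h
  refine (HasSubgaussianMGF.measure_sum_ge_le_of_iIndepFun hind hsub (by positivity)).trans (le_of_eq ?_)
  rcases Nat.eq_zero_or_pos S.card with h | h
  · simp [h]
  · have h' : (S.card : ℝ) ≠ 0 := by exact_mod_cast h.ne'
    congr 1
    simp only [Finset.sum_const, nsmul_eq_mul, mul_one, NNReal.coe_natCast]
    field_simp

theorem measure_pi_bool_abs_sum_ge_le {ι : Type} [Fintype ι] (p : ι → PMF Bool) (S : Finset ι)
    {δ : ℝ} (hδ : 0 ≤ δ) :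
    (Measure.pi fun l => (p l).toMeasure)
        {ν | S.card * δ ≤ |∑ l ∈ S, (spin (ν l) - ∫ x, spin x ∂(p l).toMeasure)|}
      ≤ ENNReal.ofReal (2 * Real.exp (-(S.card * δ ^ 2 / 2))) := by
  have h1 := measure_pi_bool_sum_ge_le p spin (by intro x; cases x <;> simp [spin]) S hδ
  have h2 := measure_pi_bool_sum_ge_le p (fun x => -spin x)
    (by intro x; cases x <;> simp [spin]) S hδ
  rw [← ofReal_measureReal]
  refine ENNReal.ofReal_le_ofReal ?_
  have hsub : {ν : ι → Bool | S.card * δ ≤ |∑ l ∈ S, (spin (ν l) - ∫ x, spin x ∂(p l).toMeasure)|}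
      ⊆ {ν | S.card * δ ≤ ∑ l ∈ S, (spin (ν l) - ∫ x, spin x ∂(p l).toMeasure)}
        ∪ {ν | S.card * δ ≤ ∑ l ∈ S, (-spin (ν l) - ∫ x, -spin x ∂(p l).toMeasure)} := by
    intro ν hν
    rcases le_abs.1 (Set.mem_ofPred.1 hν) with h | h
    · exact Or.inl h
    · refine Or.inr (h.trans (le_of_eq ?_))
      rw [← Finset.sum_neg_distrib]
      refine Finset.sum_congr rfl fun l _ => ?_
      rw [integral_neg]
      ring
  have := (measureReal_mono (μ := Measure.pi fun l => (p l).toMeasure) hsub).trans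
    (measureReal_union_le _ _)
  linarith

/-! ### Recovering a phase from coarse data at dyadic scales -/

/-- The two quadratures `cos` and `sin`. -/
noncomputable def quadrature (b : Bool) (x : ℝ) : ℝ := if b then Real.cos x else Real.sin x

/-- The phase `θ` reproduces the data `X k b ≈ quadrature b (2 ^ k θ)` up to `1 / 3`. -/
def PhaseConsistent (K : ℕ) (X : ℕ → Bool → ℝ) (θ : ℝ) : Prop :=
  |θ| ≤ 2 ∧ ∀ k < K, ∀ b, |quadrature b (2 ^ k * θ) - X k b| < 1 / 3

open Classical in
/-- Some phase consistent with the data. -/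
noncomputable def phaseEstimate (K : ℕ) (X : ℕ → Bool → ℝ) : ℝ :=
  if h : ∃ θ, PhaseConsistent K X θ then h.choose else 0

/-- Each coordinate of `e^{ix} - e^{iy}` is below `2/3`, so `2 - 2 cos (x - y) < 8/9` and the cosine
exceeds `5/9`. -/
theorem half_lt_cos_sub {x y u v : ℝ} (hx : |Real.cos x - u| < 1 / 3)
    (hx' : |Real.sin x - v| < 1 / 3) (hy : |Real.cos y - u| < 1 / 3)
    (hy' : |Real.sin y - v| < 1 / 3) : 1 / 2 < Real.cos (x - y) := by
  have h1 : |Real.cos x - Real.cos y| < 2 / 3 := by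
    rw [abs_lt] at *
    constructor <;> linarith
  have h2 : |Real.sin x - Real.sin y| < 2 / 3 := by
    rw [abs_lt] at *
    constructor <;> linarith
  have h3 := sq_lt_sq' (abs_lt.1 h1).1 (abs_lt.1 h1).2
  have h4 := sq_lt_sq' (abs_lt.1 h2).1 (abs_lt.1 h2).2
  rw [Real.cos_sub]
  nlinarith [Real.sin_sq_add_cos_sq x, Real.sin_sq_add_cos_sq y]

/-- The next interval with cosine above `1/2` starts at `5π/3 > 4`; up to `4 < 3π/2` the cosine
stays nonpositive after `π`. -/
theorem abs_lt_pi_div_three {x : ℝ} (hx : |x| ≤ 4) (hc : 1 / 2 < Real.cos x) :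
    |x| < Real.pi / 3 := by
  have hpi := Real.pi_gt_three
  rw [← Real.cos_abs] at hc
  by_contra h
  push Not at h
  rcases le_total |x| Real.pi with h1 | h1
  · have := Real.cos_le_cos_of_nonneg_of_le_pi (by positivity) h1 h
    rw [Real.cos_pi_div_three] at this
    linarith
  · have := Real.cos_nonpos_of_pi_div_two_le_of_le (by linarith)
      (show |x| ≤ Real.pi + Real.pi / 2 by linarith)
    linarith

/-- The a priori range gives a difference of at most `4` at scale `1`. Inductively, doubling a
difference below `π/3` leaves it below `2π/3 < 4`, so the cosine test at the next scale has no
branch ambiguity. -/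
theorem PhaseConsistent.abs_sub_lt {K : ℕ} {X : ℕ → Bool → ℝ} {θ θ' : ℝ}
    (h : PhaseConsistent (K + 1) X θ) (h' : PhaseConsistent (K + 1) X θ') :
    |θ - θ'| < Real.pi / 3 / 2 ^ K := by
  have hcos : ∀ k < K + 1, 1 / 2 < Real.cos (2 ^ k * (θ - θ')) := fun k hk => by
    rw [mul_sub]
    exact half_lt_cos_sub (h.2 k hk true) (h.2 k hk false) (h'.2 k hk true) (h'.2 k hk false)
  have hind : ∀ k < K + 1, |2 ^ k * (θ - θ')| < Real.pi / 3 := fun k => by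
    induction k with
    | zero =>
      intro hk
      refine abs_lt_pi_div_three ?_ (hcos 0 hk)
      have h1 := abs_sub θ θ'
      rw [pow_zero, one_mul]
      linarith [h.1, h'.1]
    | succ k ih =>
      intro hk
      have h1 := ih (by omega)
      refine abs_lt_pi_div_three ?_ (hcos _ hk)
      rw [pow_succ, mul_comm _ (2 : ℝ), mul_assoc, abs_mul, abs_two]
      linarith [Real.pi_lt_four]
  have h1 := hind K (by omega)
  rw [abs_mul, abs_of_pos (by positivity)] at h1
  rw [lt_div_iff₀ (by positivity)]
  linarith

/-- The true phase witnesses that a consistent phase exists, and whichever one is chosen must be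
close to it. -/
theorem PhaseConsistent.abs_phaseEstimate_sub_lt {K : ℕ} {X : ℕ → Bool → ℝ} {θ : ℝ}
    (h : PhaseConsistent (K + 1) X θ) :
    |phaseEstimate (K + 1) X - θ| < Real.pi / 3 / 2 ^ K := by
  have hex : ∃ θ, PhaseConsistent (K + 1) X θ := ⟨θ, h⟩
  rw [phaseEstimate, dif_pos hex]
  exact hex.choose_spec.abs_sub_lt h

/-- The same noise, with a weaker bound. -/
def SPAMNoise.mono {ι : Type} [Fintype ι] [DecidableEq ι] {ε ε' : ℝ} (h : ε ≤ ε')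
    (noise : SPAMNoise ι ε) : SPAMNoise ι ε' where
  prep := noise.prep
  meas := noise.meas
  bound := noise.bound.trans (ENNReal.ofReal_le_ofReal h)

/-! ### Choice of parameters and failure probability -/

/-- The number of stages and of shots per stage. -/
theorem exists_stages_and_shots {η q : ℝ} (hη : 0 < η) (hη3 : η ≤ 1 / 3) (hq : 0 < q)
    (hq1 : q < 1) :
    ∃ n m : ℕ, 0 < m ∧ 2 / η < 2 ^ (n + 1) ∧ (2 : ℝ) ^ n ≤ 2 / η ∧
      4 * ((n : ℝ) + 2) * Real.exp (-(m * (7 / 100) ^ 2 / 2)) ≤ q ∧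
      (n : ℝ) + 2 ≤ 5 * Real.log (1 / η) ∧
      (m : ℝ) ≤ 100000 * (Real.log (1 / q) + Real.log (Real.log (1 / η))) := by
  obtain ⟨n, hn1, hn2⟩ := exists_nat_pow_near (show 1 ≤ 2 / η by
    rw [le_div_iff₀ hη]; linarith) (one_lt_two (α := ℝ))
  set L := Real.log (1 / η) with hL
  -- From `η ≤ 1/3` and `log 3 ≥ 2 - e/3`. This keeps `log L` bounded away from `0`, so that
  -- additive constants can be absorbed into it.
  have hL1 : 1.09 ≤ L := by
    have h1 : Real.log 3 ≤ L := by
      refine Real.log_le_log (by norm_num) ?_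
      rw [le_div_iff₀ hη]
      linarith
    have h2 : 1 - (3 / Real.exp 1)⁻¹ ≤ Real.log (3 / Real.exp 1) :=
      Real.one_sub_inv_le_log_of_pos (by positivity)
    rw [Real.log_div (by norm_num) (Real.exp_pos 1).ne', Real.log_exp, inv_div] at h2
    have := Real.exp_one_lt_d9
    linarith
  have hLL : 0.08 ≤ Real.log L := by
    refine le_trans ?_ (Real.one_sub_inv_le_log_of_pos (by linarith))
    have : L⁻¹ ≤ 1.09⁻¹ := inv_anti₀ (by norm_num) hL1
    norm_num at this ⊢
    linarith
  have hlq : 0 < Real.log (1 / q) := Real.log_pos (by rw [lt_div_iff₀ hq]; linarith)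
  have hK : (n : ℝ) + 2 ≤ 5 * L := by
    have h1 := Real.log_le_log (by positivity) hn1
    rw [Real.log_pow, div_eq_mul_one_div, Real.log_mul (by norm_num) (by positivity)] at h1
    have h2 := Real.log_two_gt_d9
    have h3 := Real.log_two_lt_d9
    have h4 : (n : ℝ) * 0.69 ≤ n * Real.log 2 := by
      gcongr
      linarith
    linarith
  have hK0 : (0 : ℝ) < 4 * ((n : ℝ) + 2) := by positivity
  have hlogK0 : 0 < Real.log (4 * ((n : ℝ) + 2)) := Real.log_pos (by
    have : (0 : ℝ) ≤ n := Nat.cast_nonneg n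
    linarith)
  have hlogK : Real.log (4 * ((n : ℝ) + 2)) ≤ 19 + Real.log L := by
    have h1 := Real.log_le_log hK0 (show 4 * ((n : ℝ) + 2) ≤ 20 * L by linarith)
    rw [Real.log_mul (x := 20) (by norm_num) (by linarith)] at h1
    have := Real.log_le_sub_one_of_pos (show (0 : ℝ) < 20 by norm_num)
    linarith
  -- `410` exceeds `2 / 0.07² ≈ 408.2`, so the Hoeffding exponent beats both logarithms.
  set x := 410 * (Real.log (4 * ((n : ℝ) + 2)) + Real.log (1 / q)) with hx
  have hx0 : 0 < x := by positivity
  have hm1 := Nat.le_ceil x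
  have hm2 := Nat.ceil_lt_add_one hx0.le
  refine ⟨n, ⌈x⌉₊, Nat.ceil_pos.2 hx0, hn2, hn1, ?_, hK, by linarith⟩
  have h1 : 4 * ((n : ℝ) + 2) = Real.exp (Real.log (4 * ((n : ℝ) + 2))) := (Real.exp_log hK0).symm
  have h2 : q = Real.exp (-Real.log (1 / q)) := by
    rw [one_div, Real.log_inv, neg_neg, Real.exp_log hq]
  rw [h1, ← Real.exp_add]
  conv_rhs => rw [h2]
  refine Real.exp_le_exp.2 ?_
  linarith

/-- If the means of the shots of each block are close to the quadratures of `2 ^ k θ`, then the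
phase estimate from the block averages fails with small probability. -/
theorem measure_pi_phaseEstimate_le {ι : Type} [Fintype ι] (n m : ℕ) (hm : 0 < m)
    (e : Fin (n + 2) × Bool × Fin m ≃ ι) (p : ι → PMF Bool) {θ η q : ℝ} (hθ : |θ| ≤ 2)
    (hη : 2 / η < 2 ^ (n + 1)) (hη0 : 0 < η)
    (hq : 4 * ((n : ℝ) + 2) * Real.exp (-(m * (7 / 100) ^ 2 / 2)) ≤ q)
    (hmean : ∀ k b i, |∫ x, spin x ∂(p (e (k, b, i))).toMeasure - quadrature b (2 ^ (k : ℕ) * θ)|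
      ≤ 0.2632) :
    (Measure.pi fun l => (p l).toMeasure) {ν | η ≤ |phaseEstimate (n + 2) (fun k b =>
        if hk : k < n + 2 then (m : ℝ)⁻¹ * ∑ i, spin (ν (e (⟨k, hk⟩, b, i))) else 0) - θ|}
      ≤ ENNReal.ofReal q := by
  classical
  have hm' : (0 : ℝ) < m := by exact_mod_cast hm
  set block : Fin (n + 2) × Bool → Finset ι := fun a =>
    Finset.univ.map ⟨fun i => e (a.1, a.2, i), fun i i' h => by simpa using h⟩ with hblock
  have hcard : ∀ a, (block a).card = m := fun a => by simp [hblock]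
  set bad : Fin (n + 2) × Bool → Set (ι → Bool) := fun a =>
    {ν | (block a).card * (7 / 100 : ℝ)
      ≤ |∑ l ∈ block a, (spin (ν l) - ∫ x, spin x ∂(p l).toMeasure)|} with hbad
  have hsub : {ν : ι → Bool | η ≤ |phaseEstimate (n + 2) (fun k b =>
        if hk : k < n + 2 then (m : ℝ)⁻¹ * ∑ i, spin (ν (e (⟨k, hk⟩, b, i))) else 0) - θ|}
      ⊆ ⋃ a ∈ (Finset.univ : Finset (Fin (n + 2) × Bool)), bad a := by
    intro ν hν
    by_contra hgood
    simp only [Finset.mem_univ, Set.iUnion_true, Set.mem_iUnion, not_exists] at hgood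
    have hcons : PhaseConsistent (n + 1 + 1) (fun k b =>
        if hk : k < n + 2 then (m : ℝ)⁻¹ * ∑ i, spin (ν (e (⟨k, hk⟩, b, i))) else 0) θ := by
      refine ⟨hθ, fun k hk b => ?_⟩
      have hk' : k < n + 2 := hk
      simp only [dif_pos hk']
      have h1 := hgood (⟨k, hk'⟩, b)
      simp only [hbad, Set.mem_ofPred_eq, not_le, hcard] at h1
      replace h1 : |∑ i, (spin (ν (e (⟨k, hk'⟩, b, i)))
          - ∫ x, spin x ∂(p (e (⟨k, hk'⟩, b, i))).toMeasure)| < m * (7 / 100) := by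
        rw [hblock, Finset.sum_map] at h1
        exact h1
      rw [Finset.sum_sub_distrib] at h1
      have h2 : |∑ i, (∫ x, spin x ∂(p (e (⟨k, hk'⟩, b, i))).toMeasure
          - quadrature b (2 ^ k * θ))| ≤ m * 0.2632 := by
        refine (Finset.abs_sum_le_sum_abs _ _).trans ?_
        refine (Finset.sum_le_card_nsmul _ _ 0.2632 fun i _ => hmean ⟨k, hk'⟩ b i).trans ?_
        simp
      rw [Finset.sum_sub_distrib, Finset.sum_const, Finset.card_univ, Fintype.card_fin,
        nsmul_eq_mul] at h2
      rw [abs_lt] at h1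
      rw [abs_le] at h2
      have h3 : m * (m : ℝ)⁻¹ = 1 := mul_inv_cancel₀ hm'.ne'
      set total := ∑ i, spin (ν (e (⟨k, hk'⟩, b, i)))
      -- The margin is `0.07 + 0.2632 = 0.3332 < 1/3`.
      have h4 : |m * (quadrature b (2 ^ k * θ) - (m : ℝ)⁻¹ * total)| < m * (1 / 3) := by
        rw [mul_sub, ← mul_assoc, h3, one_mul, abs_lt]
        constructor <;> linarith [h1.1, h1.2, h2.1, h2.2]
      rw [abs_mul, abs_of_pos hm'] at h4
      exact lt_of_mul_lt_mul_left h4 hm'.le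
    have h1 := hcons.abs_phaseEstimate_sub_lt
    -- With `n + 2` stages the finest scale is `2 ^ (n + 1) > 2/η`, and `π/3 < 2`.
    have h2 : Real.pi / 3 / 2 ^ (n + 1) < η := by
      rw [div_lt_iff₀ hη0] at hη
      rw [div_lt_iff₀ (by positivity)]
      linarith [Real.pi_lt_four]
    exact absurd (Set.mem_ofPred.1 hν) (not_le.2 (h1.trans h2))
  refine (measure_mono hsub).trans ((measure_biUnion_finset_le _ _).trans ?_)
  have hbound : ∀ a, (Measure.pi fun l => (p l).toMeasure) (bad a)
      ≤ ENNReal.ofReal (2 * Real.exp (-(m * (7 / 100) ^ 2 / 2))) := fun a =>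
    (measure_pi_bool_abs_sum_ge_le p (block a) (δ := 7 / 100) (by norm_num)).trans_eq
      (by rw [hcard])
  refine ((Finset.sum_le_card_nsmul _ _ _ fun a _ => hbound a).trans ?_).trans
    (ENNReal.ofReal_le_ofReal hq)
  -- Union bound: `2 (n + 2)` blocks, each failing with probability at most `2 exp(…)`.
  rw [nsmul_eq_mul, ← ENNReal.ofReal_natCast, ← ENNReal.ofReal_mul (Nat.cast_nonneg _)]
  refine ENNReal.ofReal_le_ofReal (le_of_eq ?_)
  simp only [Finset.card_univ, Fintype.card_prod, Fintype.card_fin, Fintype.card_bool]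
  push_cast
  ring

end HamLearn

end

/-! ### The design and its guarantees -/

theorem mainTheorem4 :
    ∃ C c : ℝ, 0 < C ∧ 0 < c ∧
      ∀ (n M : ℕ) (s : PauliString n) (j : Fin n) (hj : s j ≠ Pauli.I) (η q : ℝ),
        1 ≤ M → 0 < η → η ≤ 1 / 3 → 0 < q → q < 1 →
        ∃ (N : ℕ) (b : Fin N → Bool) (r : Fin N → ℕ) (t τ : Fin N → ℝ)
          (θhat : (Fin N → Bool) → ℝ),
          (∀ l, 1 ≤ r l ∧ 0 < τ l ∧ t l = r l * τ l) ∧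
          (N : ℝ) ≤ C * (Real.log (1 / η) *
            (Real.log (1 / q) + Real.log (Real.log (1 / η)))) ∧
          ∑ l, t l ≤ C * (1 / η * (Real.log (1 / q) + Real.log (Real.log (1 / η)))) ∧
          (∀ l, t l ≤ C * (1 / η)) ∧
          (∀ l, c * (1 / ((M : ℝ) ^ 2 * t l)) ≤ τ l) ∧
          ∀ (μ : PauliString n → ℝ), IsAdmissible M μ →
            ∀ ε : ℝ, ε ≤ 1 / (3 * √2) → ∀ noise : Fin N → SPAMNoise (Qubits n) ε,
              MeasureTheory.Measure.pi
                  (fun l => (phaseExperiment μ s j hj (noise l) (b l) (r l) (τ l)).toMeasure)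
                  {ν | η ≤ |θhat ν - 2 * μ s|} ≤ ENNReal.ofReal q := by
  refine ⟨2000000, 1 / 1000, by norm_num, by norm_num, ?_⟩
  intro n M s j hj η q hM hη hη3 hq hq1
  obtain ⟨κ, m, hm, hκ1, hκ2, hfail, hκ3, hmB⟩ := exists_stages_and_shots hη hη3 hq hq1
  set L := Real.log (1 / η)
  set B := Real.log (1 / q) + Real.log L
  have hM0 : (1 : ℝ) ≤ M := by exact_mod_cast hM
  have e : Fin (κ + 2) × Bool × Fin m ≃ Fin ((κ + 2) * (2 * m)) :=
    Fintype.equivFinOfCardEq (by simp)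
  -- Each experiment is indexed by a stage `k`, a quadrature and a shot. It has `t = 2^k` and `τ =
  -- 1/(1000 M² t)`, hence `r = 1000 M² 4^k`; nothing depends on `μ`.
  refine ⟨(κ + 2) * (2 * m), fun l => (e.symm l).2.1,
    fun l => 1000 * M ^ 2 * 4 ^ ((e.symm l).1 : ℕ), fun l => 2 ^ ((e.symm l).1 : ℕ),
    fun l => 1 / (1000 * M ^ 2 * 2 ^ ((e.symm l).1 : ℕ)),
    fun ν => phaseEstimate (κ + 2) (fun k b =>
        if hk : k < κ + 2 then (m : ℝ)⁻¹ * ∑ i, spin (ν (e (⟨k, hk⟩, b, i))) else 0),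
    ?_, ?_, ?_, ?_, ?_, ?_⟩
  · intro l
    refine ⟨Nat.succ_le_of_lt (by positivity), by positivity, ?_⟩
    push_cast
    rw [show (4 : ℝ) = 2 * 2 by norm_num, mul_pow]
    field_simp
  · push_cast
    have h1 : ((κ : ℝ) + 2) * m ≤ 5 * L * (100000 * B) :=
      mul_le_mul hκ3 hmB (Nat.cast_nonneg m) (le_trans (by positivity) hκ3)
    have h2 : 0 ≤ ((κ : ℝ) + 2) * m := by positivity
    linarith
  · rw [← e.sum_comp]
    simp only [Equiv.symm_apply_apply]
    rw [Fintype.sum_prod_type]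
    simp only [Finset.sum_const, Finset.card_univ, Fintype.card_prod, Fintype.card_bool,
      Fintype.card_fin, nsmul_eq_mul, ← Finset.mul_sum]
    rw [Fin.sum_univ_eq_sum_range (fun k => (2 : ℝ) ^ k), geom_sum_eq (by norm_num)]
    push_cast
    have h1 : ((2 : ℝ) ^ (κ + 2) - 1) / (2 - 1) ≤ 8 * (1 / η) := by
      rw [div_eq_mul_one_div 2 η] at hκ2
      rw [pow_add]
      linarith
    have h0 : (0 : ℝ) ≤ 1 / η := by positivity
    calc 2 * (m : ℝ) * (((2 : ℝ) ^ (κ + 2) - 1) / (2 - 1)) ≤ 2 * m * (8 * (1 / η)) := by gcongr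
      _ ≤ 2 * (100000 * B) * (8 * (1 / η)) := by gcongr
      _ ≤ 2000000 * (1 / η * B) := by
        have : 0 ≤ 1 / η * B := mul_nonneg h0 (by
          have : (0 : ℝ) ≤ m := Nat.cast_nonneg m
          linarith)
        linarith
  · intro l
    have h1 : (2 : ℝ) ^ ((e.symm l).1 : ℕ) ≤ 2 ^ (κ + 2) :=
      pow_le_pow_right₀ (by norm_num) (e.symm l).1.2.le
    have h0 : (0 : ℝ) ≤ 1 / η := by positivity
    rw [div_eq_mul_one_div 2 η] at hκ2
    rw [pow_add] at h1
    linarith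
  · intro l
    -- Equality holds, since `τ t = 1/(1000 M²)` in every experiment.
    refine le_of_eq ?_
    field_simp
  · intro μ hμ ε hε noise
    have hε0 : (0 : ℝ) ≤ 1 / (3 * √2) := by positivity
    have hε1 : 1 / (3 * √2) ≤ (0.2358 : ℝ) := by
      have h2 : (1.4142 : ℝ) ≤ √2 := Real.le_sqrt_of_sq_le (by norm_num)
      rw [div_le_iff₀ (by positivity)]
      linarith
    refine measure_pi_phaseEstimate_le κ m hm e
      (fun l => phaseExperiment μ s j hj (noise l) (e.symm l).2.1
        (1000 * M ^ 2 * 4 ^ ((e.symm l).1 : ℕ)) (1 / (1000 * M ^ 2 * 2 ^ ((e.symm l).1 : ℕ))))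
      ?_ hκ1 hη hfail ?_
    · rw [abs_mul, abs_two]
      linarith [hμ.bounded s]
    · intro k b i
      simp only [Equiv.symm_apply_apply]
      have hp : (1 : ℝ) ≤ 2 ^ (k : ℕ) := one_le_pow₀ (by norm_num)
      have hτM : (M : ℝ) * (1 / (1000 * M ^ 2 * 2 ^ (k : ℕ))) ≤ 1 := by
        rw [mul_one_div, div_le_one (by positivity)]
        nlinarith [mul_le_mul hM0 hp zero_le_one (by positivity)]
      -- The noise is weakened to strength `1/(3√2)`, which supplies the nonnegativity that `ε`
      -- itself is not assumed to have.
      have h := abs_integral_phaseExperiment_sub_le hμ hM s j hj hε0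
        ((noise (e (k, b, i))).mono hε) b (1000 * M ^ 2 * 4 ^ (k : ℕ))
        (τ := 1 / (1000 * M ^ 2 * 2 ^ (k : ℕ))) (by positivity) hτM
      have h4 : (4 : ℝ) ^ (k : ℕ) = 2 ^ (k : ℕ) * 2 ^ (k : ℕ) := by
        rw [← mul_pow]
        norm_num
      have ht : ((1000 * M ^ 2 * 4 ^ (k : ℕ) : ℕ) : ℝ) * (1 / (1000 * M ^ 2 * 2 ^ (k : ℕ)))
          = 2 ^ (k : ℕ) := by
        push_cast
        rw [h4]
        field_simp
      -- The reshaping error `26 r (Mτ)²` equals `26/1000` at every stage, independently of `M` and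
      -- `k`.
      have herr : ((1000 * M ^ 2 * 4 ^ (k : ℕ) : ℕ) : ℝ)
          * (26 * ((M : ℝ) * (1 / (1000 * M ^ 2 * 2 ^ (k : ℕ)))) ^ 2) = 0.026 := by
        push_cast
        rw [h4]
        field_simp
        norm_num
      rw [ht, herr, mul_comm (2 * μ s)] at h
      -- `0.2358 + 0.026 = 0.2618`, within the allowed bias `0.2632`.
      exact h.trans (by linarith)
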